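/- Let $\mathcal C$ be an additive braided monoidal category with braiding $C$ and unit object $I$, whose tensor product is bilinear on morphisms (associators and unitors are suppressed below). The braiding is called symmetric on a family $E$ of objects if $C_{U,V}=(C_{V,U})^{-1}$ for all $U,V\in E$. Definitions. For an object $L$ on which $C$ is symmetric, put $C_{12}=C_{L,L}\otimes \mathrm{id}$, $C_{23}=\mathrm{id}\otimes C_{L,L}$. A braided Lie algebra is such an $L$ with a morphism $[\,,]:L\otimes L\to L$ such that $[\,,](\mathrm{id}+C_{L,L})=0$ and $[\,,]([\,,]\otimes\mathrm{id})(\mathrm{id}+C_{12}C_{23}+C_{23}C_{12})=0$. A braided Lie coalgebra is such an $L$ with a morphism $\delta:L\to L\otimes L$ such that $(\mathrm{id}+C_{L,L})\delta=0$ and $(\mathrm{id}+C_{12}C_{23}+C_{23}C_{12})(\delta\otimes\mathrm{id})\delta=0$. For a bracket and a cobracket on $L$ put $\Theta_L=([\,,]\otimes\mathrm{id})(\mathrm{id}\otimes\delta)+(\mathrm{id}\otimes[\,,])(C_{L,L}\otimes\mathrm{id})(\mathrm{id}\otimes\delta)$. A braided Lie bialgebra is a braided Lie algebra and braided Lie coalgebra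 with $\delta[\,,]=\Theta_L(\mathrm{id}-C_{L,L})$. A co-quasitriangular braided Lie bialgebra $(H,r)$ is a braided Lie bialgebra $H$ with a morphism $r:H\otimes H\to I$ such that $$[\,,]=(\mathrm{id}\otimes r)(\delta\otimes\mathrm{id})+(\mathrm{id}\otimes r)(C_{H,H}\otimes\mathrm{id})(\mathrm{id}\otimes\delta),$$ $$(r\otimes r)\big[(\mathrm{id}\otimes C_{H,H}\otimes\mathrm{id})(\delta\otimes\mathrm{id}\otimes\mathrm{id})+(\mathrm{id}\otimes\delta\otimes\mathrm{id})+(\mathrm{id}\otimes C_{H,H}\otimes\mathrm{id})(\mathrm{id}\otimes\mathrm{id}\otimes\delta)\big]=0 .$$ A left $H$-comodule is an object $A$ with $\phi:A\to H\otimes A$ such that $(\delta_H\otimes\mathrm{id})\phi=(\mathrm{id}\otimes\phi)\phi-(C_{H,H}\otimes\mathrm{id})(\mathrm{id}\otimes\phi)\phi$. It is an $H$-comodule braided Lie algebra (resp. coalgebra) if it is moreover a braided Lie algebra (resp. coalgebra) with $$\phi[\,,]_A=(\mathrm{id}\otimes[\,,]_A)(\phi\otimes\mathrm{id})+(\mathrm{id}\otimes[\,,]_A)(C_{A,H}\otimes\mathrm{id})(\mathrm{id}\otimes\phi)$$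 $$\text{(resp. } (\mathrm{id}\otimes\delta_A)\phi=(\phi\otimes\mathrm{id})\delta_A+(C_{A,H}\otimes\mathrm{id})(\mathrm{id}\otimes\phi)\delta_A\text{)}.$$ Theorem. Suppose that $C$ is symmetric on $\{A,H\}$, that $(H,r)$ is a co-quasitriangular braided Lie bialgebra, and that $(A,\phi)$ is an $H$-comodule braided Lie algebra and, with the same $\phi$, an $H$-comodule braided Lie coalgebra. Define $$\alpha=(r\otimes\mathrm{id}_A)(C_{H,H}\otimes\mathrm{id}_A)(\mathrm{id}_H\otimes\phi):H\otimes A\to A .$$ Suppose that the following condition (SLB) holds on $A\otimes A$: $$\delta_A[\,,]_A=\Theta_A(\mathrm{id}-C_{A,A})-{}^S C,$$ where $$\begin{aligned}{}^S C={}&(\alpha\otimes\mathrm{id})(C_{A,H}\otimes\mathrm{id})(\mathrm{id}\otimes\phi)+(\mathrm{id}\otimes\alpha)(C_{H,A}\otimes\mathrm{id})(\phi\otimes\mathrm{id})-(\alpha\otimes\mathrm{id})(\mathrm{id}\otimes C_{A,A})(\phi\otimes\mathrm{id})\\&-(\mathrm{id}\otimes\alpha)(C_{H,A}\otimes\mathrm{id})(\mathrm{id}\otimes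 C_{A,A})(C_{A,H}\otimes\mathrm{id})(\mathrm{id}\otimes\phi).\end{aligned}$$ Then the bisum of $A$ and $H$, that is, the object $A\oplus H$ with the bracket whose components are $[\,,]_A$ on $A\otimes A$, $\alpha$ on $H\otimes A$, $-\alpha C_{A,H}$ on $A\otimes H$ and $[\,,]_H$ on $H\otimes H$, and with the cobracket whose components are $\delta_A+\phi-C_{H,A}\phi$ on $A$ and $\delta_H$ on $H$, is a braided Lie bialgebra in $\mathcal C$. -/

import Mathlib

open CategoryTheory MonoidalCategory Limits

universe v u

/-! Braided Lie algebras, coalgebras and bialgebras in an additive braided monoidal category.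
Composition `f ≫ g` is in diagrammatic order; all associators and unitors are explicit. -/

namespace BraidedLie

section Lie

variable {C : Type u} [Category.{v} C] [MonoidalCategory C] [BraidedCategory C]

/-- The braiding is symmetric on a family `E` of objects:
`C_{U,V} = (C_{V,U})⁻¹` for all `U, V ∈ E`. -/
def IsSymmetricOn (E : Set C) : Prop :=
  ∀ U ∈ E, ∀ V ∈ E, (β_ U V).hom = (β_ V U).inv

/-- `C₁₂ = C_{L,L} ⊗ id_L`. -/
def braid12 (L : C) : (L ⊗ L) ⊗ L ⟶ (L ⊗ L) ⊗ L :=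
  (β_ L L).hom ▷ L

/-- `C₂₃ = id_L ⊗ C_{L,L}`. -/
def braid23 (L : C) : (L ⊗ L) ⊗ L ⟶ (L ⊗ L) ⊗ L :=
  (α_ L L L).hom ≫ L ◁ (β_ L L).hom ≫ (α_ L L L).inv

variable [Preadditive C]

/-- A braided Lie algebra `(L, [ , ])`: an object on which the braiding is symmetric, with a
bracket satisfying braided antisymmetry and the braided Jacobi identity. -/
structure IsBraidedLieAlgebra (L : C) (br : L ⊗ L ⟶ L) : Prop where
  symm : IsSymmetricOn ({L} : Set C)
  antisymm : (𝟙 (L ⊗ L) + (β_ L L).hom) ≫ br = 0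
  jacobi :
    (𝟙 ((L ⊗ L) ⊗ L) + braid23 L ≫ braid12 L + braid12 L ≫ braid23 L) ≫ br ▷ L ≫ br = 0

/-- A braided Lie coalgebra `(L, δ)`: an object on which the braiding is symmetric, with a
cobracket satisfying braided co-antisymmetry and the braided co-Jacobi identity. -/
structure IsBraidedLieCoalgebra (L : C) (δ : L ⟶ L ⊗ L) : Prop where
  symm : IsSymmetricOn ({L} : Set C)
  antisymm : δ ≫ (𝟙 (L ⊗ L) + (β_ L L).hom) = 0
  jacobi :
    δ ≫ δ ▷ L ≫ (𝟙 ((L ⊗ L) ⊗ L) + braid23 L ≫ braid12 L + braid12 L ≫ braid23 L) = 0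

/-- On elements `x ⊗ y ↦ [x, y₁] ⊗ y₂ + y₁ ⊗ [x, y₂]`, that is, the morphism
`([,] ⊗ id)(id ⊗ δ) + (id ⊗ [,])(C ⊗ id)(id ⊗ δ)`. -/
def adCobracket (L : C) (br : L ⊗ L ⟶ L) (δ : L ⟶ L ⊗ L) : L ⊗ L ⟶ L ⊗ L :=
  L ◁ δ ≫ (α_ L L L).inv ≫ br ▷ L
    + L ◁ δ ≫ (α_ L L L).inv ≫ (β_ L L).hom ▷ L ≫ (α_ L L L).hom ≫ L ◁ br

/-- A braided Lie bialgebra: a braided Lie algebra and a braided Lie coalgebra whose cobracket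
is a `1`-cocycle. -/
structure IsBraidedLieBialgebra (H : C) (br : H ⊗ H ⟶ H) (δ : H ⟶ H ⊗ H) : Prop where
  lieAlgebra : IsBraidedLieAlgebra H br
  lieCoalgebra : IsBraidedLieCoalgebra H δ
  cocycle : br ≫ δ = (𝟙 (H ⊗ H) - (β_ H H).hom) ≫ adCobracket H br δ

/-- On elements `(x, y, z) ↦ r(x₁, y) r(x₂, z)`. -/
def ccybe₁ (H : C) (δ : H ⟶ H ⊗ H) (r : H ⊗ H ⟶ 𝟙_ C) : H ⊗ (H ⊗ H) ⟶ 𝟙_ C :=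
  δ ▷ (H ⊗ H) ≫ tensorμ H H H H ≫ (r ⊗ₘ r) ≫ (λ_ (𝟙_ C)).hom

/-- On elements `(x, y, z) ↦ r(x, y₁) r(y₂, z)`. -/
def ccybe₂ (H : C) (δ : H ⟶ H ⊗ H) (r : H ⊗ H ⟶ 𝟙_ C) : H ⊗ (H ⊗ H) ⟶ 𝟙_ C :=
  H ◁ (δ ▷ H) ≫ H ◁ (α_ H H H).hom ≫ (α_ H H (H ⊗ H)).inv ≫ (r ⊗ₘ r) ≫ (λ_ (𝟙_ C)).hom

/-- On elements `(x, y, z) ↦ r(x, z₁) r(y, z₂)`. -/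
def ccybe₃ (H : C) (δ : H ⟶ H ⊗ H) (r : H ⊗ H ⟶ 𝟙_ C) : H ⊗ (H ⊗ H) ⟶ 𝟙_ C :=
  H ◁ (H ◁ δ) ≫ (α_ H H (H ⊗ H)).inv ≫ tensorμ H H H H ≫ (r ⊗ₘ r) ≫ (λ_ (𝟙_ C)).hom

/-- A co-quasitriangular braided Lie bialgebra `(H, r)`. On elements, `bracket_eq` reads
`[x, y] = x₁ r(x₂, y) + y₁ r(x, y₂)`, and `ccybe` is the classical co-Yang-Baxter equation. -/
structure IsCoquasitriangular (H : C) (br : H ⊗ H ⟶ H) (δ : H ⟶ H ⊗ H)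
    (r : H ⊗ H ⟶ 𝟙_ C) : Prop where
  bialgebra : IsBraidedLieBialgebra H br δ
  bracket_eq : br =
    δ ▷ H ≫ (α_ H H H).hom ≫ H ◁ r ≫ (ρ_ H).hom
      + H ◁ δ ≫ (α_ H H H).inv ≫ (β_ H H).hom ▷ H ≫ (α_ H H H).hom ≫ H ◁ r ≫ (ρ_ H).hom
  ccybe : ccybe₁ H δ r + ccybe₂ H δ r + ccybe₃ H δ r = 0

/-- `(A, φ)` is a left comodule over the braided Lie coalgebra `(H, δH)`:
`(δ ⊗ id) φ = (id ⊗ φ) φ - (C_{H,H} ⊗ id)(id ⊗ φ) φ`. -/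
def IsLeftComodule (H A : C) (δH : H ⟶ H ⊗ H) (φ : A ⟶ H ⊗ A) : Prop :=
  φ ≫ δH ▷ A =
    φ ≫ H ◁ φ ≫ (α_ H H A).inv - φ ≫ H ◁ φ ≫ (α_ H H A).inv ≫ (β_ H H).hom ▷ A

/-- `A` is a left `H`-comodule braided Lie algebra: a braided Lie algebra and a left
`H`-comodule whose bracket is a comodule morphism. -/
structure IsComoduleLieAlgebra (H A : C) (δH : H ⟶ H ⊗ H) (brA : A ⊗ A ⟶ A)
    (φ : A ⟶ H ⊗ A) : Prop where
  lieAlgebra : IsBraidedLieAlgebra A brA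
  comodule : IsLeftComodule H A δH φ
  bracket_colinear : brA ≫ φ =
    φ ▷ A ≫ (α_ H A A).hom ≫ H ◁ brA
      + A ◁ φ ≫ (α_ A H A).inv ≫ (β_ A H).hom ▷ A ≫ (α_ H A A).hom ≫ H ◁ brA

/-- `A` is a left `H`-comodule braided Lie coalgebra: a braided Lie coalgebra and a left
`H`-comodule whose cobracket is a comodule morphism. -/
structure IsComoduleLieCoalgebra (H A : C) (δH : H ⟶ H ⊗ H) (δA : A ⟶ A ⊗ A)
    (φ : A ⟶ H ⊗ A) : Prop where
  lieCoalgebra : IsBraidedLieCoalgebra A δA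
  comodule : IsLeftComodule H A δH φ
  cobracket_colinear : φ ≫ H ◁ δA =
    δA ≫ φ ▷ A ≫ (α_ H A A).hom
      + δA ≫ A ◁ φ ≫ (α_ A H A).inv ≫ (β_ A H).hom ▷ A ≫ (α_ H A A).hom

/-- The action of `H` on an `H`-comodule `(A, φ)` induced by `r`,
`α = (r ⊗ id)(C_{H,H} ⊗ id)(id ⊗ φ)`; on elements `h ⊗ a ↦ r(a₍₋₁₎, h) a₍₀₎`. -/
def inducedAction (H A : C) (r : H ⊗ H ⟶ 𝟙_ C) (φ : A ⟶ H ⊗ A) : H ⊗ A ⟶ A :=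
  H ◁ φ ≫ (α_ H H A).inv ≫ (β_ H H).hom ▷ A ≫ r ▷ A ≫ (λ_ A).hom

/-- The infinitesimal braiding of an action `act` and a coaction `φ`; on elements
`a ⊗ b ↦ b₍₋₁₎·a ⊗ b₍₀₎ + a₍₀₎ ⊗ a₍₋₁₎·b - a₍₋₁₎·b ⊗ a₍₀₎ - b₍₀₎ ⊗ b₍₋₁₎·a`. -/
def infinitesimalBraiding (H A : C) (act : H ⊗ A ⟶ A) (φ : A ⟶ H ⊗ A) : A ⊗ A ⟶ A ⊗ A :=
  A ◁ φ ≫ (α_ A H A).inv ≫ (β_ A H).hom ▷ A ≫ act ▷ A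
    + φ ▷ A ≫ (β_ H A).hom ▷ A ≫ (α_ A H A).hom ≫ A ◁ act
    - φ ▷ A ≫ (α_ H A A).hom ≫ H ◁ (β_ A A).hom ≫ (α_ H A A).inv ≫ act ▷ A
    - A ◁ φ ≫ (α_ A H A).inv ≫ (β_ A H).hom ▷ A ≫ (α_ H A A).hom ≫ H ◁ (β_ A A).hom
        ≫ (α_ H A A).inv ≫ (β_ H A).hom ▷ A ≫ (α_ A H A).hom ≫ A ◁ act

/-- The condition (SLB) on `A ⊗ A`: the cocycle condition for `A`, corrected by the
infinitesimal braiding. -/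
def SLB (H A : C) (brA : A ⊗ A ⟶ A) (δA : A ⟶ A ⊗ A) (act : H ⊗ A ⟶ A)
    (φ : A ⟶ H ⊗ A) : Prop :=
  brA ≫ δA =
    (𝟙 (A ⊗ A) - (β_ A A).hom) ≫ adCobracket A brA δA - infinitesimalBraiding H A act φ

variable [HasBinaryBiproducts C]

/-- The bracket of the bisum on `A ⊕ H`: the sum of the brackets of `A` and `H`, of the action
on `H ⊗ A`, and of minus the braiding followed by the action on `A ⊗ H`. -/
noncomputable def bisumBracket (H A : C) (brH : H ⊗ H ⟶ H) (brA : A ⊗ A ⟶ A)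
    (act : H ⊗ A ⟶ A) : (A ⊞ H) ⊗ (A ⊞ H) ⟶ A ⊞ H :=
  ((biprod.fst : A ⊞ H ⟶ A) ⊗ₘ (biprod.fst : A ⊞ H ⟶ A)) ≫ brA ≫ biprod.inl
    + ((biprod.snd : A ⊞ H ⟶ H) ⊗ₘ (biprod.fst : A ⊞ H ⟶ A)) ≫ act ≫ biprod.inl
    - ((biprod.fst : A ⊞ H ⟶ A) ⊗ₘ (biprod.snd : A ⊞ H ⟶ H)) ≫ (β_ A H).hom ≫ act ≫ biprod.inl
    + ((biprod.snd : A ⊞ H ⟶ H) ⊗ₘ (biprod.snd : A ⊞ H ⟶ H)) ≫ brH ≫ biprod.inr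

/-- The cobracket of the bisum on `A ⊕ H`: `δ_A + φ - C_{H,A} φ` on `A`, and `δ_H` on `H`. -/
noncomputable def bisumCobracket (H A : C) (δH : H ⟶ H ⊗ H) (δA : A ⟶ A ⊗ A)
    (φ : A ⟶ H ⊗ A) : A ⊞ H ⟶ (A ⊞ H) ⊗ (A ⊞ H) :=
  biprod.fst ≫ δA ≫ ((biprod.inl : A ⟶ A ⊞ H) ⊗ₘ (biprod.inl : A ⟶ A ⊞ H))
    + biprod.fst ≫ φ ≫ ((biprod.inr : H ⟶ A ⊞ H) ⊗ₘ (biprod.inl : A ⟶ A ⊞ H))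
    - biprod.fst ≫ φ ≫ (β_ H A).hom ≫ ((biprod.inl : A ⟶ A ⊞ H) ⊗ₘ (biprod.inr : H ⟶ A ⊞ H))
    + biprod.snd ≫ δH ≫ ((biprod.inr : H ⟶ A ⊞ H) ⊗ₘ (biprod.inr : H ⟶ A ⊞ H))

end Lie

end BraidedLie

/-! The pairing turns the `H`-comodule `A` into a crossed module, and the theorem is bosonisation
for crossed modules (`bisum_isBraidedLieBialgebra`). Write φ(a) = a₋₁ ⊗ a₀ and h·a = r(a₋₁, h) a₀,
with signs and permutations coming from the braiding.

The formula for the bracket of `H`, the co-Yang–Baxter equation and co-antisymmetry give r(u, [h,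
k]) = r(u₂, h) r(u₁, k) (`op_pairing_bracket`). With coassociativity of the coaction in its Lie
form, this makes α an action (`op_action_bracket`). Colinearity of the bracket and of the cobracket
of `A` makes α act by derivations and coderivations. Expanding [h, a₋₁] = −[a₋₁, h] by the bracket
formula gives the crossed-module identity φ(h·a) = [h, a₋₁] ⊗ a₀ + a₋₁ ⊗ h·a₀ + h₁ ⊗ h₂·a
(`op_action_coaction`).

The axioms of the bisum are then checked on the summands of tensor powers of `A ⊞ H`. Each component
is an axiom of `A` or `H`, or one of the compatibilities above. (SLB) enters at exactly one place,
the component A ⊗ A → A ⊗ A of the cocycle condition: there the terms φ − Cφ of the cobracket,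
bracketed through α, contribute precisely the infinitesimal braiding with a minus sign.

To calculate as in a strict category, every identity is stated on right-associated words with an
arbitrary tail `Z`. The generators `op21`, `op12`, `op20`, `op11` and `swap` act at the head of a
word, and left whiskering moves them inward. Setting the tail to the unit recovers the original
identity. -/

set_option linter.unusedSectionVars false

namespace BraidedLie

/-! ### Generators acting at the head of a right-associated word. -/

section Operations

variable {C : Type u} [Category.{v} C] [MonoidalCategory C]

/-- A morphism `X₁ ⊗ X₂ ⟶ Y` applied to the first two factors of a right-associated word. -/
def op21 {X₁ X₂ Y : C} (f : X₁ ⊗ X₂ ⟶ Y) (Z : C) : X₁ ⊗ (X₂ ⊗ Z) ⟶ Y ⊗ Z :=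
  (α_ X₁ X₂ Z).inv ≫ f ▷ Z

/-- A morphism `X ⟶ Y₁ ⊗ Y₂` applied to the first factor of a right-associated word. -/
def op12 {X Y₁ Y₂ : C} (f : X ⟶ Y₁ ⊗ Y₂) (Z : C) : X ⊗ Z ⟶ Y₁ ⊗ (Y₂ ⊗ Z) :=
  f ▷ Z ≫ (α_ Y₁ Y₂ Z).hom

/-- A pairing applied to the first two factors of a right-associated word. -/
def op20 {X₁ X₂ : C} (f : X₁ ⊗ X₂ ⟶ 𝟙_ C) (Z : C) : X₁ ⊗ (X₂ ⊗ Z) ⟶ Z :=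
  (α_ X₁ X₂ Z).inv ≫ f ▷ Z ≫ (λ_ Z).hom

lemma whiskerRight_eq_op21 {X₁ X₂ Y : C} (f : X₁ ⊗ X₂ ⟶ Y) (Z : C) :
    f ▷ Z = (α_ X₁ X₂ Z).hom ≫ op21 f Z := by simp [op21]

lemma whiskerRight_eq_op12 {X Y₁ Y₂ : C} (f : X ⟶ Y₁ ⊗ Y₂) (Z : C) :
    f ▷ Z = op12 f Z ≫ (α_ Y₁ Y₂ Z).inv := by simp [op12]

lemma whiskerRight_eq_op20 {X₁ X₂ : C} (f : X₁ ⊗ X₂ ⟶ 𝟙_ C) (Z : C) :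
    f ▷ Z = (α_ X₁ X₂ Z).hom ≫ op20 f Z ≫ (λ_ Z).inv := by simp [op20]

lemma op21_naturality {X₁ X₂ Y : C} (f : X₁ ⊗ X₂ ⟶ Y) {Z Z' : C} (g : Z ⟶ Z') :
    op21 f Z ≫ Y ◁ g = X₁ ◁ X₂ ◁ g ≫ op21 f Z' := by
  simp [op21, ← whisker_exchange]

lemma op21_naturality_assoc {X₁ X₂ Y : C} (f : X₁ ⊗ X₂ ⟶ Y) {Z Z' : C} (g : Z ⟶ Z') {K : C}
    (k : Y ⊗ Z' ⟶ K) :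
    op21 f Z ≫ Y ◁ g ≫ k =
      X₁ ◁ X₂ ◁ g ≫ op21 f Z' ≫ k := by
  simpa only [Category.assoc] using eq_whisker (op21_naturality f g) k

lemma op12_naturality {X Y₁ Y₂ : C} (f : X ⟶ Y₁ ⊗ Y₂) {Z Z' : C} (g : Z ⟶ Z') :
    X ◁ g ≫ op12 f Z' = op12 f Z ≫ Y₁ ◁ Y₂ ◁ g := by
  simp [op12, whisker_exchange_assoc]

lemma op12_naturality_assoc {X Y₁ Y₂ : C} (f : X ⟶ Y₁ ⊗ Y₂) {Z Z' : C} (g : Z ⟶ Z') {K : C}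
    (k : Y₁ ⊗ Y₂ ⊗ Z' ⟶ K) :
    X ◁ g ≫ op12 f Z' ≫ k =
      op12 f Z ≫ Y₁ ◁ Y₂ ◁ g ≫ k := by
  simpa only [Category.assoc] using eq_whisker (op12_naturality f g) k

lemma op20_naturality {X₁ X₂ : C} (f : X₁ ⊗ X₂ ⟶ 𝟙_ C) {Z Z' : C} (g : Z ⟶ Z') :
    op20 f Z ≫ g = X₁ ◁ X₂ ◁ g ≫ op20 f Z' := by
  simp only [op20, Category.assoc]
  rw [← leftUnitor_naturality, ← whisker_exchange_assoc]
  simp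

lemma op20_naturality_assoc {X₁ X₂ : C} (f : X₁ ⊗ X₂ ⟶ 𝟙_ C) {Z Z' : C} (g : Z ⟶ Z') {K : C}
    (k : Z' ⟶ K) :
    op20 f Z ≫ g ≫ k =
      X₁ ◁ X₂ ◁ g ≫ op20 f Z' ≫ k := by
  simpa only [Category.assoc] using eq_whisker (op20_naturality f g) k

lemma associator_hom_whiskerRight (X Y W Z : C) :
    (α_ X Y W).hom ▷ Z = (α_ (X ⊗ Y) W Z).hom ≫ (α_ X Y (W ⊗ Z)).hom ≫
      X ◁ (α_ Y W Z).inv ≫ (α_ X (Y ⊗ W) Z).inv := by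
  monoidal

lemma associator_inv_whiskerRight (X Y W Z : C) :
    (α_ X Y W).inv ▷ Z = (α_ X (Y ⊗ W) Z).hom ≫ X ◁ (α_ Y W Z).hom ≫
      (α_ X Y (W ⊗ Z)).inv ≫ (α_ (X ⊗ Y) W Z).inv := by
  monoidal

section Braiding

variable [BraidedCategory C]

/-- The braiding applied to the first two factors of a right-associated word. -/
def swap (X Y Z : C) : X ⊗ (Y ⊗ Z) ⟶ Y ⊗ (X ⊗ Z) :=
  (α_ X Y Z).inv ≫ (β_ X Y).hom ▷ Z ≫ (α_ Y X Z).hom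

lemma braiding_whiskerRight_eq_swap (X Y Z : C) :
    (β_ X Y).hom ▷ Z = (α_ X Y Z).hom ≫ swap X Y Z ≫ (α_ Y X Z).inv := by simp [swap]

lemma swap_naturality (X Y : C) {Z Z' : C} (g : Z ⟶ Z') :
    swap X Y Z ≫ Y ◁ X ◁ g = X ◁ Y ◁ g ≫ swap X Y Z' := by
  simp only [swap, Category.assoc]
  rw [← associator_naturality_right, ← whisker_exchange_assoc]
  simp

lemma swap_naturality_assoc (X Y : C) {Z Z' : C} (g : Z ⟶ Z') {K : C} (k : Y ⊗ X ⊗ Z' ⟶ K) :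
    swap X Y Z ≫ Y ◁ X ◁ g ≫ k =
      X ◁ Y ◁ g ≫ swap X Y Z' ≫ k := by
  simpa only [Category.assoc] using eq_whisker (swap_naturality X Y g) k

/-- Naturality of the braiding in `f`, with the braiding past X₁ ⊗ X₂ split by the hexagon into two
swaps. The next three lemmas are its variants for the other side and for cooperations. -/
lemma op21_swap_right {X₁ X₂ Y : C} (f : X₁ ⊗ X₂ ⟶ Y) (X Z : C) :
    X ◁ op21 f Z ≫ swap X Y Z =
      swap X X₁ (X₂ ⊗ Z) ≫ X₁ ◁ swap X X₂ Z ≫ op21 f (X ⊗ Z) := by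
  have := congrArg (· ▷ Z) (BraidedCategory.braiding_naturality_right X f)
  simp only [comp_whiskerRight, BraidedCategory.braiding_tensor_right_hom, whisker_assoc,
    whiskerRight_tensor_symm,
    associator_hom_whiskerRight, associator_inv_whiskerRight, Category.assoc] at this
  simp only [whiskerRight_eq_op21 f, braiding_whiskerRight_eq_swap, whiskerLeft_comp,
    Category.assoc, Iso.inv_hom_id_assoc,
    whiskerLeft_inv_hom_assoc] at this
  simp only [← Category.assoc, cancel_mono] at this
  simp only [Category.assoc, cancel_epi] at this
  exact this

lemma op21_swap_right_assoc {X₁ X₂ Y : C} (f : X₁ ⊗ X₂ ⟶ Y) (X Z : C) {K : C} (k : Y ⊗ X ⊗ Z ⟶ K) :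
    X ◁ op21 f Z ≫ swap X Y Z ≫ k =
      swap X X₁ (X₂ ⊗ Z) ≫ X₁ ◁ swap X X₂ Z ≫ op21 f (X ⊗ Z) ≫ k := by
  simpa only [Category.assoc] using eq_whisker (op21_swap_right f X Z) k

lemma op21_swap_left {X₁ X₂ Y : C} (f : X₁ ⊗ X₂ ⟶ Y) (X Z : C) :
    op21 f (X ⊗ Z) ≫ swap Y X Z =
      X₁ ◁ swap X₂ X Z ≫ swap X₁ X (X₂ ⊗ Z) ≫ X ◁ op21 f Z := by
  have := congrArg (· ▷ Z) (BraidedCategory.braiding_naturality_left f X)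
  simp only [comp_whiskerRight, BraidedCategory.braiding_tensor_left_hom, whisker_assoc,
    whiskerRight_tensor_symm,
    associator_hom_whiskerRight, associator_inv_whiskerRight, Category.assoc] at this
  simp only [whiskerRight_eq_op21 f, braiding_whiskerRight_eq_swap, whiskerLeft_comp,
    Category.assoc, Iso.inv_hom_id_assoc,
    whiskerLeft_inv_hom_assoc] at this
  simp only [← Category.assoc, cancel_mono] at this
  simp only [Category.assoc, cancel_epi] at this
  exact this

lemma op21_swap_left_assoc {X₁ X₂ Y : C} (f : X₁ ⊗ X₂ ⟶ Y) (X Z : C) {K : C} (k : X ⊗ Y ⊗ Z ⟶ K) :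
    op21 f (X ⊗ Z) ≫ swap Y X Z ≫ k =
      X₁ ◁ swap X₂ X Z ≫ swap X₁ X (X₂ ⊗ Z) ≫ X ◁ op21 f Z ≫ k := by
  simpa only [Category.assoc] using eq_whisker (op21_swap_left f X Z) k

lemma swap_op12_left {X Y₁ Y₂ : C} (f : X ⟶ Y₁ ⊗ Y₂) (W Z : C) :
    swap W X Z ≫ op12 f (W ⊗ Z) =
      W ◁ op12 f Z ≫ swap W Y₁ (Y₂ ⊗ Z) ≫ Y₁ ◁ swap W Y₂ Z := by
  have := congrArg (· ▷ Z) (BraidedCategory.braiding_naturality_right W f)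
  simp only [comp_whiskerRight, BraidedCategory.braiding_tensor_right_hom, whisker_assoc,
    whiskerRight_tensor_symm,
    associator_hom_whiskerRight, associator_inv_whiskerRight, Category.assoc] at this
  simp only [whiskerRight_eq_op12 f, braiding_whiskerRight_eq_swap, whiskerLeft_comp,
    Category.assoc, Iso.inv_hom_id_assoc,
    whiskerLeft_inv_hom_assoc] at this
  simp only [← Category.assoc, cancel_mono] at this
  simp only [Category.assoc, cancel_epi] at this
  exact this.symm

lemma swap_op12_left_assoc {X Y₁ Y₂ : C} (f : X ⟶ Y₁ ⊗ Y₂) (W Z : C) {K : C}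
    (k : Y₁ ⊗ Y₂ ⊗ W ⊗ Z ⟶ K) :
    swap W X Z ≫ op12 f (W ⊗ Z) ≫ k =
      W ◁ op12 f Z ≫ swap W Y₁ (Y₂ ⊗ Z) ≫ Y₁ ◁ swap W Y₂ Z ≫ k := by
  simpa only [Category.assoc] using eq_whisker (swap_op12_left f W Z) k

lemma swap_op12_right {X Y₁ Y₂ : C} (f : X ⟶ Y₁ ⊗ Y₂) (W Z : C) :
    swap X W Z ≫ W ◁ op12 f Z =
      op12 f (W ⊗ Z) ≫ Y₁ ◁ swap Y₂ W Z ≫ swap Y₁ W (Y₂ ⊗ Z) := by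
  have := congrArg (· ▷ Z) (BraidedCategory.braiding_naturality_left f W)
  simp only [comp_whiskerRight, BraidedCategory.braiding_tensor_left_hom, whisker_assoc,
    whiskerRight_tensor_symm,
    associator_hom_whiskerRight, associator_inv_whiskerRight, Category.assoc] at this
  simp only [whiskerRight_eq_op12 f, braiding_whiskerRight_eq_swap, whiskerLeft_comp,
    Category.assoc, Iso.inv_hom_id_assoc,
    whiskerLeft_inv_hom_assoc] at this
  simp only [← Category.assoc, cancel_mono] at this
  simp only [Category.assoc, cancel_epi] at this
  exact this.symm

lemma swap_op12_right_assoc {X Y₁ Y₂ : C} (f : X ⟶ Y₁ ⊗ Y₂) (W Z : C) {K : C}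
    (k : W ⊗ Y₁ ⊗ Y₂ ⊗ Z ⟶ K) :
    swap X W Z ≫ W ◁ op12 f Z ≫ k =
      op12 f (W ⊗ Z) ≫ Y₁ ◁ swap Y₂ W Z ≫ swap Y₁ W (Y₂ ⊗ Z) ≫ k := by
  simpa only [Category.assoc] using eq_whisker (swap_op12_right f W Z) k

/-- A pairing lands in the unit, which braids trivially with `X`; hence both of its arguments may be
carried past `X` before contracting. Used from left to right, it drives pairings towards the tail.
-/
lemma op20_tensor {X₁ X₂ : C} (f : X₁ ⊗ X₂ ⟶ 𝟙_ C) (X Z : C) :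
    op20 f (X ⊗ Z) =
      X₁ ◁ swap X₂ X Z ≫ swap X₁ X (X₂ ⊗ Z) ≫ X ◁ op20 f Z := by
  have := congrArg (· ▷ Z) (BraidedCategory.braiding_naturality_left f X)
  simp only [comp_whiskerRight, BraidedCategory.braiding_tensor_left_hom, braiding_tensorUnit_left,
    whisker_assoc, whiskerRight_tensor_symm, associator_hom_whiskerRight,
    associator_inv_whiskerRight, Category.assoc] at this
  simp only [whiskerRight_eq_op20 f, braiding_whiskerRight_eq_swap, whiskerLeft_comp,
    Category.assoc, Iso.inv_hom_id_assoc, whiskerLeft_inv_hom_assoc,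
    cancel_epi] at this
  rw [← cancel_mono (X ◁ (λ_ Z).inv), ← cancel_mono (α_ X (𝟙_ C) Z).inv]
  simp only [Category.assoc]
  rw [← this]
  congr 1
  monoidal

lemma whiskerLeft_whiskerLeft_inv_hom (X Y : C) {U V W : C} (e : U ≅ V) (g : X ⊗ Y ⊗ V ⟶ W) :
    X ◁ Y ◁ e.inv ≫ X ◁ Y ◁ e.hom ≫ g = g := by
  simp [← whiskerLeft_comp_assoc]

lemma swap_yang_baxter (X Y W Z : C) :
    swap X Y (W ⊗ Z) ≫ Y ◁ swap X W Z ≫ swap Y W (X ⊗ Z) =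
      X ◁ swap Y W Z ≫ swap X W (Y ⊗ Z) ≫ W ◁ swap X Y Z := by
  have := congrArg (· ▷ Z) (BraidedCategory.yang_baxter X Y W)
  simp only [comp_whiskerRight, whisker_assoc, whiskerRight_tensor_symm,
    associator_hom_whiskerRight, associator_inv_whiskerRight, Category.assoc] at this
  simp only [braiding_whiskerRight_eq_swap, whiskerLeft_comp, Category.assoc, Iso.inv_hom_id_assoc,
    whiskerLeft_inv_hom_assoc] at this
  simp only [← Category.assoc, cancel_mono] at this
  simp only [Category.assoc, cancel_epi] at this
  exact this

lemma swap_yang_baxter_assoc (X Y W Z : C) {K : C} (k : W ⊗ Y ⊗ X ⊗ Z ⟶ K) :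
    swap X Y (W ⊗ Z) ≫ Y ◁ swap X W Z ≫ swap Y W (X ⊗ Z) ≫ k =
      X ◁ swap Y W Z ≫ swap X W (Y ⊗ Z) ≫ W ◁ swap X Y Z ≫ k := by
  simpa only [Category.assoc] using eq_whisker (swap_yang_baxter X Y W Z) k

lemma swap_swap {X Y : C} (h : (β_ X Y).hom = (β_ Y X).inv) (Z : C) :
    swap X Y Z ≫ swap Y X Z = 𝟙 _ := by
  simp [swap, h]

lemma swap_swap_assoc {X Y : C} (h : (β_ X Y).hom = (β_ Y X).inv) (Z : C) {K : C}
    (k : X ⊗ Y ⊗ Z ⟶ K) :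
    swap X Y Z ≫ swap Y X Z ≫ k =
      k := by
  simpa only [Category.assoc, Category.id_comp] using eq_whisker (swap_swap h Z) k

end Braiding

end Operations

/-! ### Oriented rewriting rules for words. -/

section Rules

variable {C : Type u} [Category.{v} C] [MonoidalCategory C] [BraidedCategory C]

/-- The rules of this section are oriented towards one normal form: cooperations first, then swaps,
then brackets and pairings, with independent swaps performed innermost first. Whiskered and
reassociated copies let `simp` apply them in the middle of a composite. -/
lemma whiskerLeft_op12_naturality_assoc {X Y₁ Y₂ : C} (f : X ⟶ Y₁ ⊗ Y₂) {Z Z' : C} (g : Z ⟶ Z')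
    (S : C) {K : C} (k : _ ⟶ K) :
    S ◁ X ◁ g ≫ S ◁ op12 f Z' ≫ k =
      S ◁ op12 f Z ≫ S ◁ Y₁ ◁ Y₂ ◁ g ≫ k := by
  simpa only [whiskerLeft_comp, whiskerLeft_id, Category.assoc, Category.id_comp] using
    congrArg (fun t => (S ◁ t) ≫ k) (op12_naturality f g)

lemma whiskerLeft_swap_op12_left_assoc {X Y₁ Y₂ : C} (f : X ⟶ Y₁ ⊗ Y₂) (W Z : C) (S : C) {K : C}
    (k : _ ⟶ K) :
    S ◁ swap W X Z ≫ S ◁ op12 f (W ⊗ Z) ≫ k =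
      S ◁ W ◁ op12 f Z ≫ S ◁ swap W Y₁ (Y₂ ⊗ Z) ≫ S ◁ Y₁ ◁ swap W Y₂ Z ≫ k := by
  simpa only [whiskerLeft_comp, whiskerLeft_id, Category.assoc, Category.id_comp] using
    congrArg (fun t => (S ◁ t) ≫ k) (swap_op12_left f W Z)

lemma whiskerLeft_whiskerLeft_swap_op12_left_assoc {X Y₁ Y₂ : C} (f : X ⟶ Y₁ ⊗ Y₂) (W Z : C)
    (S T : C) {K : C} (k : _ ⟶ K) :
    S ◁ T ◁ swap W X Z ≫ S ◁ T ◁ op12 f (W ⊗ Z) ≫ k =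
      S ◁ T ◁ W ◁ op12 f Z ≫ S ◁ T ◁ swap W Y₁ (Y₂ ⊗ Z) ≫ S ◁ T ◁ Y₁ ◁ swap W Y₂ Z ≫ k := by
  simpa only [whiskerLeft_comp, whiskerLeft_id, Category.assoc, Category.id_comp] using
    congrArg (fun t => (S ◁ T ◁ t) ≫ k) (swap_op12_left f W Z)

lemma whiskerLeft_swap_yang_baxter_assoc (X Y W Z : C) (S : C) {K : C} (k : _ ⟶ K) :
    S ◁ swap X Y (W ⊗ Z) ≫ S ◁ Y ◁ swap X W Z ≫ S ◁ swap Y W (X ⊗ Z) ≫ k =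
      S ◁ X ◁ swap Y W Z ≫ S ◁ swap X W (Y ⊗ Z) ≫ S ◁ W ◁ swap X Y Z ≫ k := by
  simpa only [whiskerLeft_comp, whiskerLeft_id, Category.assoc, Category.id_comp] using
    congrArg (fun t => (S ◁ t) ≫ k) (swap_yang_baxter X Y W Z)

lemma whiskerLeft_whiskerLeft_swap_yang_baxter_assoc (X Y W Z : C) (S T : C) {K : C} (k : _ ⟶ K) :
    S ◁ T ◁ swap X Y (W ⊗ Z) ≫ S ◁ T ◁ Y ◁ swap X W Z ≫ S ◁ T ◁ swap Y W (X ⊗ Z) ≫ k =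
      S ◁ T ◁ X ◁ swap Y W Z ≫ S ◁ T ◁ swap X W (Y ⊗ Z) ≫ S ◁ T ◁ W ◁ swap X Y Z ≫ k := by
  simpa only [whiskerLeft_comp, whiskerLeft_id, Category.assoc, Category.id_comp] using
    congrArg (fun t => (S ◁ T ◁ t) ≫ k) (swap_yang_baxter X Y W Z)

lemma whiskerLeft_swap_swap_assoc {X Y : C} (h : (β_ X Y).hom = (β_ Y X).inv) (Z : C) (S : C)
    {K : C} (k : _ ⟶ K) :
    S ◁ swap X Y Z ≫ S ◁ swap Y X Z ≫ k =
      k := by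
  simpa only [whiskerLeft_comp, whiskerLeft_id, Category.assoc, Category.id_comp] using
    congrArg (fun t => (S ◁ t) ≫ k) (swap_swap h Z)

lemma whiskerLeft_whiskerLeft_swap_swap_assoc {X Y : C} (h : (β_ X Y).hom = (β_ Y X).inv) (Z : C)
    (S T : C) {K : C} (k : _ ⟶ K) :
    S ◁ T ◁ swap X Y Z ≫ S ◁ T ◁ swap Y X Z ≫ k =
      k := by
  simpa only [whiskerLeft_comp, whiskerLeft_id, Category.assoc, Category.id_comp] using
    congrArg (fun t => (S ◁ T ◁ t) ≫ k) (swap_swap h Z)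

lemma whiskerLeft_whiskerLeft_whiskerLeft_swap_swap_assoc {X Y : C}
    (h : (β_ X Y).hom = (β_ Y X).inv) (Z : C) (S T T' : C) {K : C} (k : _ ⟶ K) :
    S ◁ T ◁ T' ◁ swap X Y Z ≫ S ◁ T ◁ T' ◁ swap Y X Z ≫ k =
      k := by
  simpa only [whiskerLeft_comp, whiskerLeft_id, Category.assoc, Category.id_comp] using
    congrArg (fun t => (S ◁ T ◁ T' ◁ t) ≫ k) (swap_swap h Z)

lemma swap_op12_exchange_assoc {P Q₁ Q₂ : C} (f : P ⟶ Q₁ ⊗ Q₂) (X Y Z : C) {K : C} (k : _ ⟶ K) :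
    swap X Y (P ⊗ Z) ≫ Y ◁ X ◁ op12 f Z ≫ k =
      X ◁ Y ◁ op12 f Z ≫ swap X Y (Q₁ ⊗ Q₂ ⊗ Z) ≫ k := by
  simpa only [whiskerLeft_comp, whiskerLeft_id, Category.assoc, Category.id_comp] using
    congrArg (fun t => t ≫ k) (swap_naturality X Y (op12 f Z))

lemma whiskerLeft_swap_op12_exchange_assoc {P Q₁ Q₂ : C} (f : P ⟶ Q₁ ⊗ Q₂) (X Y Z : C) (S : C)
    {K : C} (k : _ ⟶ K) :
    S ◁ swap X Y (P ⊗ Z) ≫ S ◁ Y ◁ X ◁ op12 f Z ≫ k =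
      S ◁ X ◁ Y ◁ op12 f Z ≫ S ◁ swap X Y (Q₁ ⊗ Q₂ ⊗ Z) ≫ k := by
  simpa only [whiskerLeft_comp, whiskerLeft_id, Category.assoc, Category.id_comp] using
    congrArg (fun t => (S ◁ t) ≫ k) (swap_naturality X Y (op12 f Z))

lemma swap_swap_exchange_assoc (X Y P Q Z : C) {K : C} (k : _ ⟶ K) :
    swap X Y (P ⊗ Q ⊗ Z) ≫ Y ◁ X ◁ swap P Q Z ≫ k =
      X ◁ Y ◁ swap P Q Z ≫ swap X Y (Q ⊗ P ⊗ Z) ≫ k := by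
  simpa only [whiskerLeft_comp, whiskerLeft_id, Category.assoc, Category.id_comp] using
    congrArg (fun t => t ≫ k) (swap_naturality X Y (swap P Q Z))

lemma whiskerLeft_swap_swap_exchange_assoc (X Y P Q Z : C) (S : C) {K : C} (k : _ ⟶ K) :
    S ◁ swap X Y (P ⊗ Q ⊗ Z) ≫ S ◁ Y ◁ X ◁ swap P Q Z ≫ k =
      S ◁ X ◁ Y ◁ swap P Q Z ≫ S ◁ swap X Y (Q ⊗ P ⊗ Z) ≫ k := by
  simpa only [whiskerLeft_comp, whiskerLeft_id, Category.assoc, Category.id_comp] using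
    congrArg (fun t => (S ◁ t) ≫ k) (swap_naturality X Y (swap P Q Z))

lemma whiskerLeft_op20_swap_exchange_assoc {P Q : C} (f : P ⊗ Q ⟶ 𝟙_ C) (X Y Z : C) (S : C)
    {K : C} (k : _ ⟶ K) :
    S ◁ X ◁ Y ◁ op20 f Z ≫ S ◁ swap X Y (Z) ≫ k =
      S ◁ swap X Y (P ⊗ Q ⊗ Z) ≫ S ◁ Y ◁ X ◁ op20 f Z ≫ k := by
  simpa only [whiskerLeft_comp, whiskerLeft_id, Category.assoc, Category.id_comp] using
    congrArg (fun t => (S ◁ t) ≫ k) ((swap_naturality X Y (op20 f Z)).symm)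

lemma op20_op21_exchange {P Q X Y W : C} (f : P ⊗ Q ⟶ 𝟙_ C) (g : X ⊗ Y ⟶ W) (Z : C) :
    X ◁ Y ◁ op20 f Z ≫ op21 g (Z) =
      op21 g (P ⊗ Q ⊗ Z) ≫ W ◁ op20 f Z := by
  simpa only [whiskerLeft_comp, whiskerLeft_id, Category.assoc] using
    congrArg (fun t => t) ((op21_naturality g (op20 f Z)).symm)

lemma op21_swap_exchange_assoc {X Y W : C} (g : X ⊗ Y ⟶ W) (P Q Z : C) {K : C} (k : _ ⟶ K) :
    op21 g (P ⊗ Q ⊗ Z) ≫ W ◁ swap P Q Z ≫ k =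
      X ◁ Y ◁ swap P Q Z ≫ op21 g (Q ⊗ P ⊗ Z) ≫ k := by
  simpa only [whiskerLeft_comp, whiskerLeft_id, Category.assoc, Category.id_comp] using
    congrArg (fun t => t ≫ k) (op21_naturality g (swap P Q Z))

lemma swap_op12_exchange_whiskerLeft_assoc {P Q₁ Q₂ : C} (f : P ⟶ Q₁ ⊗ Q₂) (X Y U Z : C) {K : C}
    (k : _ ⟶ K) :
    swap X Y (U ⊗ P ⊗ Z) ≫ Y ◁ X ◁ U ◁ op12 f Z ≫ k =
      X ◁ Y ◁ U ◁ op12 f Z ≫ swap X Y (U ⊗ Q₁ ⊗ Q₂ ⊗ Z) ≫ k := by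
  simpa only [whiskerLeft_comp, whiskerLeft_id, Category.assoc, Category.id_comp] using
    congrArg (fun t => t ≫ k) (swap_naturality X Y (U ◁ op12 f Z))

lemma swap_swap_exchange_whiskerLeft_assoc (X Y U P Q Z : C) {K : C} (k : _ ⟶ K) :
    swap X Y (U ⊗ P ⊗ Q ⊗ Z) ≫ Y ◁ X ◁ U ◁ swap P Q Z ≫ k =
      X ◁ Y ◁ U ◁ swap P Q Z ≫ swap X Y (U ⊗ Q ⊗ P ⊗ Z) ≫ k := by
  simpa only [whiskerLeft_comp, whiskerLeft_id, Category.assoc, Category.id_comp] using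
    congrArg (fun t => t ≫ k) (swap_naturality X Y (U ◁ swap P Q Z))

lemma op20_swap_exchange_whiskerLeft_assoc {P Q : C} (f : P ⊗ Q ⟶ 𝟙_ C) (X Y U Z : C) {K : C}
    (k : _ ⟶ K) :
    X ◁ Y ◁ U ◁ op20 f Z ≫ swap X Y (U ⊗ Z) ≫ k =
      swap X Y (U ⊗ P ⊗ Q ⊗ Z) ≫ Y ◁ X ◁ U ◁ op20 f Z ≫ k := by
  simpa only [whiskerLeft_comp, whiskerLeft_id, Category.assoc, Category.id_comp] using
    congrArg (fun t => t ≫ k) ((swap_naturality X Y (U ◁ op20 f Z)).symm)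

lemma whiskerLeft_op21_swap_right_assoc {X₁ X₂ Y : C} (f : X₁ ⊗ X₂ ⟶ Y) (X Z : C) (S : C) {K : C}
    (k : _ ⟶ K) :
    S ◁ X ◁ op21 f Z ≫ S ◁ swap X Y Z ≫ k =
      S ◁ swap X X₁ (X₂ ⊗ Z) ≫ S ◁ X₁ ◁ swap X X₂ Z ≫ S ◁ op21 f (X ⊗ Z) ≫ k := by
  simpa only [whiskerLeft_comp, whiskerLeft_id, Category.assoc, Category.id_comp] using
    congrArg (fun t => (S ◁ t) ≫ k) (op21_swap_right f X Z)

/-- The braid relation s₁s₂s₁ = s₂s₁s₂ with the commuting s₃ interposed. The exchange rule turns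
s₁s₂s₁s₃ into s₁s₂s₃s₁ and so hides the plain Yang–Baxter pattern. -/
lemma swap_coxeter_assoc (X Y V W Z : C) {K : C} (k : _ ⟶ K) :
    swap X Y (V ⊗ W ⊗ Z) ≫ Y ◁ swap X V (W ⊗ Z) ≫ Y ◁ V ◁ swap X W Z ≫ swap Y V (W ⊗ X ⊗ Z) ≫ k =
      X ◁ swap Y V (W ⊗ Z) ≫ swap X V (Y ⊗ W ⊗ Z) ≫ V ◁ swap X Y (W ⊗ Z) ≫ V ◁ Y ◁ swap X W Z ≫
        k := by
  have e := congrArg (fun t => t ≫ k) (by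
    rw [← swap_naturality Y V (swap X W Z), swap_yang_baxter_assoc] : swap X Y (V ⊗ W ⊗ Z) ≫
      Y ◁ swap X V (W ⊗ Z) ≫ Y ◁ V ◁ swap X W Z ≫ swap Y V (W ⊗ X ⊗ Z) = X ◁ swap Y V (W ⊗ Z) ≫
      swap X V (Y ⊗ W ⊗ Z) ≫ V ◁ swap X Y (W ⊗ Z) ≫ V ◁ Y ◁ swap X W Z)
  simpa only [whiskerLeft_comp, whiskerLeft_id, Category.assoc, Category.id_comp] using e

lemma whiskerLeft_swap_coxeter_assoc (X Y V W Z : C) (S : C) {K : C} (k : _ ⟶ K) :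
    S ◁ swap X Y (V ⊗ W ⊗ Z) ≫ S ◁ Y ◁ swap X V (W ⊗ Z) ≫ S ◁ Y ◁ V ◁ swap X W Z ≫
      S ◁ swap Y V (W ⊗ X ⊗ Z) ≫ k =
      S ◁ X ◁ swap Y V (W ⊗ Z) ≫ S ◁ swap X V (Y ⊗ W ⊗ Z) ≫ S ◁ V ◁ swap X Y (W ⊗ Z) ≫
        S ◁ V ◁ Y ◁ swap X W Z ≫ k := by
  have e := congrArg (fun t => (S ◁ t) ≫ k) (by
    rw [← swap_naturality Y V (swap X W Z), swap_yang_baxter_assoc] : swap X Y (V ⊗ W ⊗ Z) ≫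
      Y ◁ swap X V (W ⊗ Z) ≫ Y ◁ V ◁ swap X W Z ≫ swap Y V (W ⊗ X ⊗ Z) = X ◁ swap Y V (W ⊗ Z) ≫
      swap X V (Y ⊗ W ⊗ Z) ≫ V ◁ swap X Y (W ⊗ Z) ≫ V ◁ Y ◁ swap X W Z)
  simpa only [whiskerLeft_comp, whiskerLeft_id, Category.assoc, Category.id_comp] using e

attribute [simp] op12_naturality_assoc op12_naturality whiskerLeft_op12_naturality_assoc
  swap_op12_left_assoc whiskerLeft_swap_op12_left_assoc
  whiskerLeft_whiskerLeft_swap_op12_left_assoc swap_op12_right_assoc swap_op12_right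
  swap_yang_baxter_assoc whiskerLeft_swap_yang_baxter_assoc
  whiskerLeft_whiskerLeft_swap_yang_baxter_assoc swap_op12_exchange_assoc
  whiskerLeft_swap_op12_exchange_assoc swap_swap_exchange_assoc
  whiskerLeft_swap_swap_exchange_assoc whiskerLeft_op20_swap_exchange_assoc op20_op21_exchange
  op21_swap_exchange_assoc swap_op12_exchange_whiskerLeft_assoc
  swap_swap_exchange_whiskerLeft_assoc op20_swap_exchange_whiskerLeft_assoc op21_swap_left_assoc
  op21_swap_right_assoc whiskerLeft_op21_swap_right_assoc swap_coxeter_assoc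
  whiskerLeft_swap_coxeter_assoc op20_tensor

end Rules

/-! ### The hypotheses as identities between words. -/

section Words

variable {C : Type u} [Category.{v} C] [MonoidalCategory C] [BraidedCategory C] [Preadditive C]
  [MonoidalPreadditive C]

lemma neg_whiskerRight' {X Y : C} (f : X ⟶ Y) (Z : C) : (-f) ▷ Z = -(f ▷ Z) :=
  (tensorRight Z).map_neg

lemma sub_whiskerRight' {X Y : C} (f g : X ⟶ Y) (Z : C) : (f - g) ▷ Z = f ▷ Z - g ▷ Z :=
  (tensorRight Z).map_sub

lemma whiskerLeft_neg' {X Y : C} (f : X ⟶ Y) (Z : C) : Z ◁ (-f) = -(Z ◁ f) :=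
  (tensorLeft Z).map_neg

lemma whiskerLeft_sub' {X Y : C} (f g : X ⟶ Y) (Z : C) : Z ◁ (f - g) = Z ◁ f - Z ◁ g :=
  (tensorLeft Z).map_sub

lemma op21_inducedAction (H A : C) (r : H ⊗ H ⟶ 𝟙_ C) (φ : A ⟶ H ⊗ A) (Z : C) :
    op21 (inducedAction H A r φ) Z =
      H ◁ op12 φ Z ≫ swap H H (A ⊗ Z) ≫ op20 r (A ⊗ Z) := by
  rw [← cancel_epi (α_ H A Z).hom, ← whiskerRight_eq_op21, inducedAction]
  simp only [comp_whiskerRight, whisker_assoc, whiskerRight_tensor_symm,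
    associator_inv_whiskerRight, Category.assoc]
  simp only [whiskerRight_eq_op12 φ, whiskerRight_eq_op20 r, leftUnitor_whiskerRight,
    braiding_whiskerRight_eq_swap, whiskerLeft_comp, Category.assoc, Iso.inv_hom_id_assoc,
    whiskerLeft_inv_hom_assoc]
  simp

lemma op21_bracket_eq {H : C} {br : H ⊗ H ⟶ H} {δ : H ⟶ H ⊗ H} {r : H ⊗ H ⟶ 𝟙_ C}
    (h : IsCoquasitriangular H br δ r) (Z : C) :
    op21 br Z = op12 δ (H ⊗ Z) ≫ H ◁ op20 r Z +
      H ◁ op12 δ Z ≫ swap H H (H ⊗ Z) ≫ H ◁ op20 r Z := by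
  rw [← cancel_epi (α_ H H Z).hom, ← whiskerRight_eq_op21, h.bracket_eq]
  simp only [comp_whiskerRight, whisker_assoc, whiskerRight_tensor_symm,
    MonoidalPreadditive.add_whiskerRight,
    associator_hom_whiskerRight, associator_inv_whiskerRight, Category.assoc]
  simp only [whiskerRight_eq_op12 δ, whiskerRight_eq_op20 r, braiding_whiskerRight_eq_swap,
    whiskerLeft_comp, Category.assoc, Iso.inv_hom_id_assoc,
    whiskerLeft_inv_hom_assoc]
  simp

lemma op_ccybe {H : C} {br : H ⊗ H ⟶ H} {δ : H ⟶ H ⊗ H} {r : H ⊗ H ⟶ 𝟙_ C}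
    (h : IsCoquasitriangular H br δ r) (Z : C) :
    op12 δ (H ⊗ H ⊗ Z) ≫ H ◁ swap H H (H ⊗ Z) ≫ op20 r (H ⊗ H ⊗ Z) ≫ op20 r Z +
    H ◁ op12 δ (H ⊗ Z) ≫ op20 r (H ⊗ H ⊗ Z) ≫ op20 r Z +
    H ◁ H ◁ op12 δ Z ≫ H ◁ swap H H (H ⊗ Z) ≫ op20 r (H ⊗ H ⊗ Z) ≫ op20 r Z = 0 := by
  -- The simultaneous contraction by r ⊗ r is replaced by two successive contractions at the head of
  -- the word.
  have hr : (r ⊗ₘ r) ≫ (λ_ (𝟙_ C)).hom = r ▷ (H ⊗ H) ≫ (λ_ (H ⊗ H)).hom ≫ r := by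
    rw [MonoidalCategory.tensorHom_def, Category.assoc, leftUnitor_naturality]
  have := congrArg (· ▷ Z) h.ccybe
  simp only [ccybe₁, ccybe₂, ccybe₃, hr, tensorμ, comp_whiskerRight, whisker_assoc,
    whiskerRight_tensor_symm, MonoidalPreadditive.add_whiskerRight,
    MonoidalPreadditive.zero_whiskerRight, leftUnitor_whiskerRight,
    associator_hom_whiskerRight, associator_inv_whiskerRight, whiskerLeft_comp,
      Category.assoc] at this
  simp only [whiskerRight_eq_op12 δ, whiskerRight_eq_op20 r, braiding_whiskerRight_eq_swap,
    whiskerLeft_comp, Category.assoc, Iso.inv_hom_id_assoc,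
    whiskerLeft_inv_hom_assoc, op20_naturality_assoc r (α_ _ _ _).hom,
      ← op12_naturality_assoc δ (α_ _ _ _).hom] at this
  simp only [← Preadditive.comp_add] at this
  rw [← cancel_epi (H ◁ (α_ H H Z).hom), ← cancel_epi (α_ H (H ⊗ H) Z).hom,
    ← cancel_mono (λ_ Z).inv]
  simp only [comp_zero, zero_comp]
  rw [← this]
  simp only [Preadditive.comp_add, Preadditive.add_comp, Category.assoc,
    whiskerLeft_whiskerLeft_inv_hom]

lemma op_comodule {H A : C} {δ : H ⟶ H ⊗ H} {φ : A ⟶ H ⊗ A} (h : IsLeftComodule H A δ φ) (Z : C) :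
    op12 φ Z ≫ op12 δ (A ⊗ Z) =
      op12 φ Z ≫ H ◁ op12 φ Z - op12 φ Z ≫ H ◁ op12 φ Z ≫ swap H H (A ⊗ Z) := by
  have := congrArg (· ▷ Z) h
  simp only [comp_whiskerRight, whisker_assoc, whiskerRight_tensor_symm, sub_whiskerRight',
    associator_inv_whiskerRight, Category.assoc] at this
  simp only [whiskerRight_eq_op12 δ, whiskerRight_eq_op12 φ,  braiding_whiskerRight_eq_swap,
    whiskerLeft_comp, Category.assoc, Iso.inv_hom_id_assoc,
    whiskerLeft_inv_hom_assoc] at this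
  simp only [← Category.assoc, cancel_mono, ← Preadditive.sub_comp] at this
  simpa only [Category.assoc] using this

lemma op_antisymm {L : C} {br : L ⊗ L ⟶ L} (h : IsBraidedLieAlgebra L br) (Z : C) :
    swap L L Z ≫ op21 br Z = - op21 br Z := by
  have := congrArg (· ▷ Z) h.antisymm
  simp only [Preadditive.add_comp, MonoidalPreadditive.add_whiskerRight,
    MonoidalPreadditive.zero_whiskerRight, comp_whiskerRight, Category.id_comp] at this
  simp only [whiskerRight_eq_op21 br, braiding_whiskerRight_eq_swap, Category.assoc,
    Iso.inv_hom_id_assoc, ← Preadditive.comp_add] at this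
  rw [← cancel_epi (α_ L L Z).hom, Preadditive.comp_neg, eq_neg_iff_add_eq_zero,
    ← Preadditive.comp_add, add_comm, this]

lemma op_coantisymm {L : C} {δ : L ⟶ L ⊗ L} (h : IsBraidedLieCoalgebra L δ) (Z : C) :
    op12 δ Z ≫ swap L L Z = - op12 δ Z := by
  have := congrArg (· ▷ Z) h.antisymm
  simp only [Preadditive.comp_add, MonoidalPreadditive.add_whiskerRight,
    MonoidalPreadditive.zero_whiskerRight, comp_whiskerRight, Category.comp_id] at this
  simp only [whiskerRight_eq_op12 δ, braiding_whiskerRight_eq_swap, Category.assoc,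
    Iso.inv_hom_id_assoc] at this
  rw [← cancel_mono (α_ L L Z).inv, Preadditive.neg_comp, eq_neg_iff_add_eq_zero, add_comm, ← this]
  simp only [Category.assoc]

lemma op_bracket_colinear {H A : C} {δ : H ⟶ H ⊗ H} {br : A ⊗ A ⟶ A} {φ : A ⟶ H ⊗ A}
    (h : IsComoduleLieAlgebra H A δ br φ) (Z : C) :
    op21 br Z ≫ op12 φ Z = op12 φ (A ⊗ Z) ≫ H ◁ op21 br Z +
      A ◁ op12 φ Z ≫ swap A H (A ⊗ Z) ≫ H ◁ op21 br Z := by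
  have := congrArg (· ▷ Z) h.bracket_colinear
  simp only [comp_whiskerRight, whisker_assoc, whiskerRight_tensor_symm,
    MonoidalPreadditive.add_whiskerRight,
    associator_hom_whiskerRight, associator_inv_whiskerRight, Category.assoc] at this
  simp only [whiskerRight_eq_op21 br, whiskerRight_eq_op12 φ,  braiding_whiskerRight_eq_swap,
    whiskerLeft_comp, Category.assoc, Iso.inv_hom_id_assoc,
    whiskerLeft_inv_hom_assoc] at this
  simp only [← Category.assoc, cancel_mono, ← Preadditive.add_comp] at this
  simp only [Category.assoc, cancel_epi, ← Preadditive.comp_add] at this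
  simpa only [Preadditive.add_comp, Category.assoc] using this

lemma op_cobracket_colinear {H A : C} {δH : H ⟶ H ⊗ H} {δ : A ⟶ A ⊗ A} {φ : A ⟶ H ⊗ A}
    (h : IsComoduleLieCoalgebra H A δH δ φ) (Z : C) :
    op12 φ Z ≫ H ◁ op12 δ Z = op12 δ Z ≫ op12 φ (A ⊗ Z) +
      op12 δ Z ≫ A ◁ op12 φ Z ≫ swap A H (A ⊗ Z) := by
  have := congrArg (· ▷ Z) h.cobracket_colinear
  simp only [comp_whiskerRight, whisker_assoc, whiskerRight_tensor_symm,
    MonoidalPreadditive.add_whiskerRight,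
    associator_hom_whiskerRight, associator_inv_whiskerRight, Category.assoc] at this
  simp only [whiskerRight_eq_op12 δ, whiskerRight_eq_op12 φ,  braiding_whiskerRight_eq_swap,
    whiskerLeft_comp, Category.assoc, Iso.inv_hom_id_assoc,
    whiskerLeft_inv_hom_assoc] at this
  simp only [← Category.assoc, cancel_mono, ← Preadditive.add_comp] at this
  simpa only [Category.assoc] using this

/-- `r(u, [h, k]) = r(u₂, h) r(u₁, k)`. -/
lemma op_pairing_bracket {H : C} {br : H ⊗ H ⟶ H} {δ : H ⟶ H ⊗ H} {r : H ⊗ H ⟶ 𝟙_ C}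
    (h : IsCoquasitriangular H br δ r) (hs : (β_ H H).hom = (β_ H H).inv) (Z : C) :
    op21 br (H ⊗ Z) ≫ swap H H Z ≫ op20 r Z =
      H ◁ H ◁ op12 δ Z ≫ H ◁ swap H H (H ⊗ Z) ≫ H ◁ op20 r (H ⊗ Z) ≫ swap H H Z ≫ op20 r Z := by
  have e : op21 br (H ⊗ Z) ≫ swap H H Z ≫ op20 r Z = - (H ◁ swap H H Z ≫ swap H H (H ⊗ Z) ≫
    op12 δ (H ⊗ H ⊗ Z) ≫ H ◁ swap H H (H ⊗ Z) ≫ H ◁ H ◁ op20 r Z ≫ op20 r Z) := by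
    rw [← op20_naturality]
    rw [op21_swap_left_assoc, op21_bracket_eq h, ← Preadditive.comp_neg, ← Preadditive.comp_neg]
    congr 2
    rw [eq_neg_iff_add_eq_zero, ← op_ccybe h Z]
    simp only [MonoidalPreadditive.whiskerLeft_add, whiskerLeft_comp, Preadditive.add_comp,
      Category.assoc,
      ← op20_naturality]
    abel
  -- Co-antisymmetry exchanges u₁ and u₂ and absorbs the sign.
  have hδ : op12 δ Z = - (op12 δ Z ≫ swap H H Z) := by
    rw [op_coantisymm h.bialgebra.lieCoalgebra, neg_neg]
  rw [e, hδ]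
  simp only [whiskerLeft_neg', Preadditive.neg_comp, neg_inj, whiskerLeft_comp, Category.assoc,
    op20_tensor,
    swap_op12_left_assoc, ← swap_naturality_assoc]
  simp only [← whiskerLeft_comp_assoc, swap_op12_left, swap_swap hs, swap_swap_assoc hs,
    swap_yang_baxter]
  simp only [whiskerLeft_comp, Category.assoc, Category.comp_id, ← swap_naturality_assoc]

end Words

/-! ### The induced action makes `A` a crossed module. -/

section Action

variable {C : Type u} [Category.{v} C] [MonoidalCategory C] [BraidedCategory C] [Preadditive C]
  [MonoidalPreadditive C] {H A : C} {brH : H ⊗ H ⟶ H} {δH : H ⟶ H ⊗ H} {r : H ⊗ H ⟶ 𝟙_ C}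
  {brA : A ⊗ A ⟶ A} {δA : A ⟶ A ⊗ A} {φ : A ⟶ H ⊗ A}

/-- Contractions of disjoint pairs of letters commute; the swaps bring the second pair to the front.
-/
lemma op20_op20_comm (Z : C) :
    H ◁ H ◁ op20 r Z ≫ op20 r Z =
      H ◁ swap H H (H ⊗ Z) ≫ swap H H (H ⊗ H ⊗ Z) ≫ H ◁ H ◁ swap H H Z ≫ H ◁ swap H H (H ⊗ Z) ≫
        H ◁ H ◁ op20 r Z ≫ op20 r Z := by
  conv_lhs => rw [← op20_naturality]
  simp

/-- Evaluate r(a₋₁, [h, k]) by `op_pairing_bracket`, then replace (δ ⊗ id)φ by the comodule axiom: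
its two terms become h·(k·a) and −k·(h·a). -/
lemma op_action_bracket (hs : (β_ H H).hom = (β_ H H).inv) (hH : IsCoquasitriangular H brH δH r)
    (hA : IsLeftComodule H A δH φ) (Z : C) :
    op21 brH (A ⊗ Z) ≫ op21 (inducedAction H A r φ) Z =
      H ◁ op21 (inducedAction H A r φ) Z ≫ op21 (inducedAction H A r φ) Z -
        swap H H (A ⊗ Z) ≫ H ◁ op21 (inducedAction H A r φ) Z ≫
          op21 (inducedAction H A r φ) Z := by
  simp only [op21_inducedAction]
  rw [op21_naturality_assoc, op_pairing_bracket hH hs]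
  simp only [← whiskerLeft_comp_assoc, Category.assoc, op_comodule hA]
  simp only [whiskerLeft_comp, Category.assoc, whiskerLeft_sub', Preadditive.sub_comp,
    swap_naturality_assoc]
  simp
  -- The scalars commute: the two pairings on the right are contracted in the other order before the
  -- words are compared.
  conv_rhs => rw [← whiskerLeft_comp A, op20_op20_comm]
  simp [whiskerLeft_whiskerLeft_swap_swap_assoc hs,
    whiskerLeft_whiskerLeft_whiskerLeft_swap_swap_assoc hs]

lemma op_action_derivation (hAH : (β_ A H).hom = (β_ H A).inv)
    (hA : IsComoduleLieAlgebra H A δH brA φ) (Z : C) :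
    H ◁ op21 brA Z ≫ op21 (inducedAction H A r φ) Z =
      op21 (inducedAction H A r φ) (A ⊗ Z) ≫ op21 brA Z +
      swap H A (A ⊗ Z) ≫ A ◁ op21 (inducedAction H A r φ) Z ≫ op21 brA Z := by
  simp only [op21_inducedAction]
  simp only [← whiskerLeft_comp_assoc, op_bracket_colinear hA]
  simp only [whiskerLeft_comp, Category.assoc, MonoidalPreadditive.whiskerLeft_add,
    Preadditive.add_comp,
    op20_naturality, swap_naturality_assoc]
  simp [whiskerLeft_swap_swap_assoc hAH]

lemma op_action_coderivation (hAH : (β_ A H).hom = (β_ H A).inv)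
    (hA : IsComoduleLieCoalgebra H A δH δA φ) (Z : C) :
    op21 (inducedAction H A r φ) Z ≫ op12 δA Z =
      H ◁ op12 δA Z ≫ op21 (inducedAction H A r φ) (A ⊗ Z) +
      H ◁ op12 δA Z ≫ swap H A (A ⊗ Z) ≫ A ◁ op21 (inducedAction H A r φ) Z := by
  simp only [op21_inducedAction, Category.assoc, op20_naturality]
  rw [swap_naturality_assoc, ← whiskerLeft_comp_assoc, op_cobracket_colinear hA]
  simp only [whiskerLeft_comp, Category.assoc, MonoidalPreadditive.whiskerLeft_add,
    Preadditive.add_comp,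
    swap_naturality_assoc]
  simp [whiskerLeft_swap_swap_assoc hAH]

/-- After expansion, −h₁ ⊗ r(a₋₁, h₂) a₀ from the bracket cancels h₁ ⊗ h₂·a. The comodule axiom
turns the other bracket term into the left-hand side minus a₋₁ ⊗ h·a₀. -/
lemma op_action_coaction (hs : (β_ H H).hom = (β_ H H).inv) (hH : IsCoquasitriangular H brH δH r)
    (hA : IsLeftComodule H A δH φ) (Z : C) :
    op21 (inducedAction H A r φ) Z ≫ op12 φ Z =
      H ◁ op12 φ Z ≫ op21 brH (A ⊗ Z) +
      H ◁ op12 φ Z ≫ swap H H (A ⊗ Z) ≫ H ◁ op21 (inducedAction H A r φ) Z +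
      op12 δH (A ⊗ Z) ≫ H ◁ op21 (inducedAction H A r φ) Z := by
  -- The bracket is reversed so that its expansion pairs with `h` in the second slot of `r`, as α
  -- does.
  have e : op21 brH (A ⊗ Z) = - swap H H (A ⊗ Z) ≫ op21 brH (A ⊗ Z) := by
    rw [op_antisymm hH.bialgebra.lieAlgebra, neg_neg]
  rw [e, op21_bracket_eq hH]
  simp only [op21_inducedAction]
  simp only [Preadditive.comp_add, Preadditive.comp_neg]
  simp only [← whiskerLeft_comp_assoc, swap_op12_left_assoc, Category.assoc, op_comodule hA]
  simp only [whiskerLeft_comp, Category.assoc, whiskerLeft_sub', Preadditive.sub_comp,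
    swap_naturality_assoc]
  simp [swap_swap_assoc hs]
  abel

end Action

/-! ### Morphisms on one letter, for the biproduct inclusions. -/

section Inclusions

variable {C : Type u} [Category.{v} C] [MonoidalCategory C] [BraidedCategory C]

/-- A morphism applied to the first factor of a right-associated word. -/
def op11 {X Y : C} (f : X ⟶ Y) (Z : C) : X ⊗ Z ⟶ Y ⊗ Z := f ▷ Z

lemma op11_naturality {X X' : C} (f : X ⟶ X') {Z Z' : C} (g : Z ⟶ Z') :
    op11 f Z ≫ X' ◁ g = X ◁ g ≫ op11 f Z' := by
  simp [op11, whisker_exchange]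

lemma op11_naturality_assoc {X X' : C} (f : X ⟶ X') {Z Z' : C} (g : Z ⟶ Z') {K : C}
    (k : X' ⊗ Z' ⟶ K) :
    op11 f Z ≫ X' ◁ g ≫ k =
      X ◁ g ≫ op11 f Z' ≫ k := by
  simpa only [Category.assoc] using eq_whisker (op11_naturality f g) k

lemma op11_swap_left {X X' : C} (f : X ⟶ X') (Y Z : C) :
    op11 f (Y ⊗ Z) ≫ swap X' Y Z = swap X Y Z ≫ Y ◁ op11 f Z := by
  have := congrArg (· ▷ Z) (BraidedCategory.braiding_naturality_left f Y)
  simp only [comp_whiskerRight, whisker_assoc, whiskerRight_tensor_symm, Category.assoc] at this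
  simp only [braiding_whiskerRight_eq_swap, Category.assoc, Iso.inv_hom_id_assoc] at this
  simp only [← Category.assoc, cancel_mono] at this
  simp only [Category.assoc, cancel_epi] at this
  exact this

lemma op11_swap_left_assoc {X X' : C} (f : X ⟶ X') (Y Z : C) {K : C} (k : Y ⊗ X' ⊗ Z ⟶ K) :
    op11 f (Y ⊗ Z) ≫ swap X' Y Z ≫ k =
      swap X Y Z ≫ Y ◁ op11 f Z ≫ k := by
  simpa only [Category.assoc] using eq_whisker (op11_swap_left f Y Z) k

lemma op11_swap_right {X X' : C} (f : X ⟶ X') (Y Z : C) :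
    Y ◁ op11 f Z ≫ swap Y X' Z = swap Y X Z ≫ op11 f (Y ⊗ Z) := by
  have := congrArg (· ▷ Z) (BraidedCategory.braiding_naturality_right Y f)
  simp only [comp_whiskerRight, whisker_assoc, whiskerRight_tensor_symm, Category.assoc] at this
  simp only [braiding_whiskerRight_eq_swap, Category.assoc, Iso.inv_hom_id_assoc] at this
  simp only [← Category.assoc, cancel_mono] at this
  simp only [Category.assoc, cancel_epi] at this
  exact this

lemma op11_swap_right_assoc {X X' : C} (f : X ⟶ X') (Y Z : C) {K : C} (k : X' ⊗ Y ⊗ Z ⟶ K) :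
    Y ◁ op11 f Z ≫ swap Y X' Z ≫ k =
      swap Y X Z ≫ op11 f (Y ⊗ Z) ≫ k := by
  simpa only [Category.assoc] using eq_whisker (op11_swap_right f Y Z) k

lemma whiskerLeft_op11_naturality_assoc {X X' : C} (f : X ⟶ X') {Z Z' : C} (g : Z ⟶ Z') (S : C)
    {K : C} (k : _ ⟶ K) :
    S ◁ op11 f Z ≫ S ◁ X' ◁ g ≫ k =
      S ◁ X ◁ g ≫ S ◁ op11 f Z' ≫ k := by
  simpa only [whiskerLeft_comp, whiskerLeft_id, Category.assoc, Category.id_comp] using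
    congrArg (fun t => (S ◁ t) ≫ k) (op11_naturality f g)

lemma whiskerLeft_op11_swap_left_assoc {X X' : C} (f : X ⟶ X') (Y Z : C) (S : C) {K : C}
    (k : _ ⟶ K) :
    S ◁ op11 f (Y ⊗ Z) ≫ S ◁ swap X' Y Z ≫ k =
      S ◁ swap X Y Z ≫ S ◁ Y ◁ op11 f Z ≫ k := by
  simpa only [whiskerLeft_comp, whiskerLeft_id, Category.assoc, Category.id_comp] using
    congrArg (fun t => (S ◁ t) ≫ k) (op11_swap_left f Y Z)

lemma whiskerLeft_op11_swap_left {X X' : C} (f : X ⟶ X') (Y Z : C) (S : C) :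
    S ◁ op11 f (Y ⊗ Z) ≫ S ◁ swap X' Y Z =
      S ◁ swap X Y Z ≫ S ◁ Y ◁ op11 f Z := by
  simpa only [whiskerLeft_comp, whiskerLeft_id, Category.assoc] using
    congrArg (fun t => S ◁ t) (op11_swap_left f Y Z)

lemma whiskerLeft_op11_swap_right_assoc {X X' : C} (f : X ⟶ X') (Y Z : C) (S : C) {K : C}
    (k : _ ⟶ K) :
    S ◁ Y ◁ op11 f Z ≫ S ◁ swap Y X' Z ≫ k =
      S ◁ swap Y X Z ≫ S ◁ op11 f (Y ⊗ Z) ≫ k := by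
  simpa only [whiskerLeft_comp, whiskerLeft_id, Category.assoc, Category.id_comp] using
    congrArg (fun t => (S ◁ t) ≫ k) (op11_swap_right f Y Z)

lemma op11_swap_exchange_assoc {P P' : C} (f : P ⟶ P') (X Y Z : C) {K : C} (k : _ ⟶ K) :
    X ◁ Y ◁ op11 f Z ≫ swap X Y (P' ⊗ Z) ≫ k =
      swap X Y (P ⊗ Z) ≫ Y ◁ X ◁ op11 f Z ≫ k := by
  simpa only [whiskerLeft_comp, whiskerLeft_id, Category.assoc, Category.id_comp] using
    congrArg (fun t => (t) ≫ k) ((swap_naturality X Y (op11 f Z)).symm)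

lemma op11_op21_exchange_assoc {P P' X Y W : C} (f : P ⟶ P') (g : X ⊗ Y ⟶ W) (Z : C) {K : C}
    (k : _ ⟶ K) :
    X ◁ Y ◁ op11 f Z ≫ op21 g (P' ⊗ Z) ≫ k =
      op21 g (P ⊗ Z) ≫ W ◁ op11 f Z ≫ k := by
  simpa only [whiskerLeft_comp, whiskerLeft_id, Category.assoc, Category.id_comp] using
    congrArg (fun t => (t) ≫ k) ((op21_naturality g (op11 f Z)).symm)

attribute [simp] op11_naturality_assoc op11_naturality whiskerLeft_op11_naturality_assoc
  op11_swap_left_assoc op11_swap_left whiskerLeft_op11_swap_left_assoc whiskerLeft_op11_swap_left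
  op11_swap_right_assoc op11_swap_right whiskerLeft_op11_swap_right_assoc op11_swap_exchange_assoc
  op11_op21_exchange_assoc

end Inclusions

/-! ### The Lie axioms and (SLB) in word form. -/

section Axioms

variable {C : Type u} [Category.{v} C] [MonoidalCategory C] [BraidedCategory C] [Preadditive C]
  [MonoidalPreadditive C]

lemma antisymm_whiskerRight {L : C} (br : L ⊗ L ⟶ L) (Z : C) :
    ((𝟙 (L ⊗ L) + (β_ L L).hom) ≫ br) ▷ Z =
      (α_ L L Z).hom ≫ (op21 br Z + swap L L Z ≫ op21 br Z) := by
  simp only [Preadditive.add_comp, MonoidalPreadditive.add_whiskerRight, comp_whiskerRight,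
    Category.id_comp, whiskerRight_eq_op21 br, braiding_whiskerRight_eq_swap, Category.assoc,
    Iso.inv_hom_id_assoc, Preadditive.comp_add]

lemma coantisymm_whiskerRight {L : C} (δ : L ⟶ L ⊗ L) (Z : C) :
    (δ ≫ (𝟙 (L ⊗ L) + (β_ L L).hom)) ▷ Z =
      (op12 δ Z + op12 δ Z ≫ swap L L Z) ≫ (α_ L L Z).inv := by
  simp only [Preadditive.comp_add, MonoidalPreadditive.add_whiskerRight, comp_whiskerRight,
    Category.comp_id, whiskerRight_eq_op12 δ, braiding_whiskerRight_eq_swap, Category.assoc,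
    Iso.inv_hom_id_assoc, Preadditive.add_comp]

lemma jacobi_whiskerRight {L : C} (br : L ⊗ L ⟶ L) (Z : C) :
    ((𝟙 ((L ⊗ L) ⊗ L) + braid23 L ≫ braid12 L + braid12 L ≫ braid23 L) ≫ br ▷ L ≫ br) ▷ Z =
      (α_ (L ⊗ L) L Z).hom ≫ (α_ L L (L ⊗ Z)).hom ≫ (op21 br (L ⊗ Z) ≫ op21 br Z +
        L ◁ swap L L Z ≫ swap L L (L ⊗ Z) ≫ op21 br (L ⊗ Z) ≫ op21 br Z +
        swap L L (L ⊗ Z) ≫ L ◁ swap L L Z ≫ op21 br (L ⊗ Z) ≫ op21 br Z) := by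
  simp only [braid12, braid23, Preadditive.add_comp, MonoidalPreadditive.add_whiskerRight,
    comp_whiskerRight,
    Category.id_comp, whisker_assoc, whiskerRight_tensor_symm,
    associator_hom_whiskerRight, associator_inv_whiskerRight, Category.assoc]
  simp only [whiskerRight_eq_op21 br, braiding_whiskerRight_eq_swap, whiskerLeft_comp,
    Category.assoc, Iso.inv_hom_id_assoc,
    whiskerLeft_inv_hom_assoc, Preadditive.comp_add]

lemma cojacobi_whiskerRight {L : C} (δ : L ⟶ L ⊗ L) (Z : C) :
    (δ ≫ δ ▷ L ≫ (𝟙 ((L ⊗ L) ⊗ L) + braid23 L ≫ braid12 L + braid12 L ≫ braid23 L)) ▷ Z =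
      (op12 δ Z ≫ op12 δ (L ⊗ Z) +
        op12 δ Z ≫ op12 δ (L ⊗ Z) ≫ L ◁ swap L L Z ≫ swap L L (L ⊗ Z) +
        op12 δ Z ≫ op12 δ (L ⊗ Z) ≫ swap L L (L ⊗ Z) ≫ L ◁ swap L L Z) ≫
          (α_ L L (L ⊗ Z)).inv ≫ (α_ (L ⊗ L) L Z).inv := by
  simp only [braid12, braid23, Preadditive.comp_add, MonoidalPreadditive.add_whiskerRight,
    comp_whiskerRight,
    Category.comp_id, whisker_assoc, whiskerRight_tensor_symm,
    associator_hom_whiskerRight, associator_inv_whiskerRight, Category.assoc]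
  simp only [whiskerRight_eq_op12 δ, braiding_whiskerRight_eq_swap, whiskerLeft_comp,
    Category.assoc, Iso.inv_hom_id_assoc,
    whiskerLeft_inv_hom_assoc, Preadditive.add_comp]

lemma adCobracket_whiskerRight {L : C} (br : L ⊗ L ⟶ L) (δ : L ⟶ L ⊗ L) (Z : C) :
    adCobracket L br δ ▷ Z = (α_ L L Z).hom ≫ (L ◁ op12 δ Z ≫ op21 br (L ⊗ Z) +
      L ◁ op12 δ Z ≫ swap L L (L ⊗ Z) ≫ L ◁ op21 br Z) ≫ (α_ L L Z).inv := by
  simp only [adCobracket, MonoidalPreadditive.add_whiskerRight, comp_whiskerRight,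
    whisker_assoc, whiskerRight_tensor_symm,
    associator_hom_whiskerRight, associator_inv_whiskerRight, Category.assoc]
  simp only [whiskerRight_eq_op12 δ, whiskerRight_eq_op21 br, braiding_whiskerRight_eq_swap,
    whiskerLeft_comp, Category.assoc, Iso.inv_hom_id_assoc,
    whiskerLeft_inv_hom_assoc, Preadditive.add_comp, Preadditive.comp_add]

lemma op_cocycle_iff {L : C} (br : L ⊗ L ⟶ L) (δ : L ⟶ L ⊗ L) (Z : C) :
    (br ≫ δ) ▷ Z = ((𝟙 (L ⊗ L) - (β_ L L).hom) ≫ adCobracket L br δ) ▷ Z ↔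
      op21 br Z ≫ op12 δ Z = (𝟙 _ - swap L L Z) ≫ (L ◁ op12 δ Z ≫ op21 br (L ⊗ Z) +
        L ◁ op12 δ Z ≫ swap L L (L ⊗ Z) ≫ L ◁ op21 br Z) := by
  have e : ((𝟙 (L ⊗ L) - (β_ L L).hom) ≫ adCobracket L br δ) ▷ Z =
     (α_ L L Z).hom ≫ ((𝟙 _ - swap L L Z) ≫ (L ◁ op12 δ Z ≫ op21 br (L ⊗ Z) +
        L ◁ op12 δ Z ≫ swap L L (L ⊗ Z) ≫ L ◁ op21 br Z)) ≫ (α_ L L Z).inv := by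
    simp only [Preadditive.sub_comp, Category.id_comp, sub_whiskerRight', comp_whiskerRight,
      adCobracket_whiskerRight,
      braiding_whiskerRight_eq_swap, Category.assoc, Iso.inv_hom_id_assoc, Preadditive.comp_sub]
  have e' : (br ≫ δ) ▷ Z = (α_ L L Z).hom ≫ (op21 br Z ≫ op12 δ Z) ≫ (α_ L L Z).inv := by
    rw [comp_whiskerRight, whiskerRight_eq_op12 δ, whiskerRight_eq_op21 br, Category.assoc,
      Category.assoc]
  rw [e, e', cancel_epi, cancel_mono]

lemma op_SLB {H A : C} {br : A ⊗ A ⟶ A} {δ : A ⟶ A ⊗ A} {act : H ⊗ A ⟶ A} {φ : A ⟶ H ⊗ A}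
    (h : SLB H A br δ act φ) (Z : C) :
    op21 br Z ≫ op12 δ Z = (𝟙 _ - swap A A Z) ≫ (A ◁ op12 δ Z ≫ op21 br (A ⊗ Z) +
        A ◁ op12 δ Z ≫ swap A A (A ⊗ Z) ≫ A ◁ op21 br Z) -
      (A ◁ op12 φ Z ≫ swap A H (A ⊗ Z) ≫ op21 act (A ⊗ Z)
        + op12 φ (A ⊗ Z) ≫ swap H A (A ⊗ Z) ≫ A ◁ op21 act Z
        - op12 φ (A ⊗ Z) ≫ H ◁ swap A A Z ≫ op21 act (A ⊗ Z)
        - A ◁ op12 φ Z ≫ swap A H (A ⊗ Z) ≫ H ◁ swap A A Z ≫ swap H A (A ⊗ Z) ≫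
          A ◁ op21 act Z) := by
  have := congrArg (· ▷ Z) h
  simp only [infinitesimalBraiding, sub_whiskerRight', MonoidalPreadditive.add_whiskerRight,
    comp_whiskerRight, Preadditive.sub_comp, Category.id_comp,
    whisker_assoc, whiskerRight_tensor_symm,
    associator_hom_whiskerRight, associator_inv_whiskerRight, Category.assoc,
      adCobracket_whiskerRight] at this
  simp only [whiskerRight_eq_op12 δ, whiskerRight_eq_op12 φ, whiskerRight_eq_op21 act,
    whiskerRight_eq_op21 br, braiding_whiskerRight_eq_swap, whiskerLeft_comp, Category.assoc,
    Iso.inv_hom_id_assoc,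
    whiskerLeft_inv_hom_assoc] at this
  simp only [← Category.assoc, ← Preadditive.add_comp, ← Preadditive.sub_comp, cancel_mono] at this
  simp only [Category.assoc, ← Preadditive.comp_add, ← Preadditive.comp_sub] at this
  rw [← cancel_epi (α_ A A Z).hom, this]
  simp only [Preadditive.comp_add, Preadditive.comp_sub, Preadditive.sub_comp, Category.id_comp,
    Category.assoc]

end Axioms

/-! ### Components of the bisum bracket and cobracket. -/

section Bisum

variable {C : Type u} [Category.{v} C] [MonoidalCategory C] [BraidedCategory C] [Preadditive C]
  [MonoidalPreadditive C] [HasBinaryBiproducts C] {H A : C}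

/-- Tensoring is additive, so `biprod.total` survives it. With the two versions at deeper letters,
this reduces every axiom to its components. -/
lemma op11_biprod_hom_ext {Z W : C} {f g : (A ⊞ H) ⊗ Z ⟶ W}
    (hA : op11 (biprod.inl : A ⟶ A ⊞ H) Z ≫ f = op11 biprod.inl Z ≫ g)
    (hH : op11 (biprod.inr : H ⟶ A ⊞ H) Z ≫ f = op11 biprod.inr Z ≫ g) : f = g := by
  have e : 𝟙 ((A ⊞ H) ⊗ Z) = op11 biprod.fst Z ≫ op11 (biprod.inl : A ⟶ A ⊞ H) Z +
      op11 biprod.snd Z ≫ op11 (biprod.inr : H ⟶ A ⊞ H) Z := by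
    simp only [op11, ← comp_whiskerRight, ← MonoidalPreadditive.add_whiskerRight, biprod.total,
      id_whiskerRight]
  rw [← Category.id_comp f, ← Category.id_comp g, e]
  simp only [Preadditive.add_comp, Category.assoc, hA, hH]

lemma whiskerLeft_op11_biprod_hom_ext {X Z W : C} {f g : X ⊗ (A ⊞ H) ⊗ Z ⟶ W}
    (hA : X ◁ op11 (biprod.inl : A ⟶ A ⊞ H) Z ≫ f = X ◁ op11 biprod.inl Z ≫ g)
    (hH : X ◁ op11 (biprod.inr : H ⟶ A ⊞ H) Z ≫ f = X ◁ op11 biprod.inr Z ≫ g) : f = g := by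
  have e : 𝟙 (X ⊗ (A ⊞ H) ⊗ Z) = X ◁ op11 biprod.fst Z ≫ X ◁ op11 (biprod.inl : A ⟶ A ⊞ H) Z +
      X ◁ op11 biprod.snd Z ≫ X ◁ op11 (biprod.inr : H ⟶ A ⊞ H) Z := by
    simp only [op11, ← comp_whiskerRight, ← whiskerLeft_comp,
      ← MonoidalPreadditive.add_whiskerRight, ← MonoidalPreadditive.whiskerLeft_add, biprod.total,
      id_whiskerRight, whiskerLeft_id]
  rw [← Category.id_comp f, ← Category.id_comp g, e]
  simp only [Preadditive.add_comp, Category.assoc, hA, hH]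

lemma whiskerLeft_whiskerLeft_op11_biprod_hom_ext {X Y Z W : C} {f g : X ⊗ Y ⊗ (A ⊞ H) ⊗ Z ⟶ W}
    (hA : X ◁ Y ◁ op11 (biprod.inl : A ⟶ A ⊞ H) Z ≫ f = X ◁ Y ◁ op11 biprod.inl Z ≫ g)
    (hH : X ◁ Y ◁ op11 (biprod.inr : H ⟶ A ⊞ H) Z ≫ f = X ◁ Y ◁ op11 biprod.inr Z ≫ g) : f = g := by
  rw [← cancel_epi (α_ X Y _).hom]
  apply whiskerLeft_op11_biprod_hom_ext <;>
  simp only [tensor_whiskerLeft, Category.assoc, Iso.inv_hom_id_assoc, hA, hH]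

variable (brH : H ⊗ H ⟶ H) (δH : H ⟶ H ⊗ H) (brA : A ⊗ A ⟶ A) (δA : A ⟶ A ⊗ A)
  (act : H ⊗ A ⟶ A) (φ : A ⟶ H ⊗ A)

lemma op21_tensorHom_comp {X X' Y Y' W : C} (i : X ⟶ X') (j : Y ⟶ Y') (f : X' ⊗ Y' ⟶ W) (Z : C) :
    X ◁ op11 j Z ≫ op11 i (Y' ⊗ Z) ≫ op21 f Z = op21 ((i ⊗ₘ j) ≫ f) Z := by
  simp [op11, op21, tensorHom_def', MonoidalCategory.tensorHom_def']

lemma op12_comp_tensorHom {X X' Y Y' W : C} (f : W ⟶ X ⊗ Y) (i : X ⟶ X') (j : Y ⟶ Y') (Z : C) :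
    op12 (f ≫ (i ⊗ₘ j)) Z = op12 f Z ≫ X ◁ op11 j Z ≫ op11 i (Y' ⊗ Z) := by
  simp [op11, op12, MonoidalCategory.tensorHom_def']

lemma op21_comp {X Y W W' : C} (f : X ⊗ Y ⟶ W) (i : W ⟶ W') (Z : C) :
    op21 (f ≫ i) Z = op21 f Z ≫ op11 i Z := by
  simp [op11, op21]

lemma op21_braiding_comp {X Y W : C} (f : Y ⊗ X ⟶ W) (Z : C) :
    op21 ((β_ X Y).hom ≫ f) Z = swap X Y Z ≫ op21 f Z := by
  simp [op21, swap]

lemma op21_neg {X Y W : C} (f : X ⊗ Y ⟶ W) (Z : C) : op21 (-f) Z = -op21 f Z := by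
  simp [op21, neg_whiskerRight']

lemma op11_op12 {W X Y W' : C} (i : W ⟶ W') (f : W' ⟶ X ⊗ Y) (Z : C) :
    op11 i Z ≫ op12 f Z = op12 (i ≫ f) Z := by
  simp [op11, op12]

lemma op12_comp_braiding {W X Y : C} (f : W ⟶ X ⊗ Y) (Z : C) :
    op12 (f ≫ (β_ X Y).hom) Z = op12 f Z ≫ swap X Y Z := by
  simp [op12, swap]

lemma op12_add {W X Y : C} (f g : W ⟶ X ⊗ Y) (Z : C) : op12 (f + g) Z = op12 f Z + op12 g Z := by
  simp [op12]

lemma op12_sub {W X Y : C} (f g : W ⟶ X ⊗ Y) (Z : C) : op12 (f - g) Z = op12 f Z - op12 g Z := by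
  simp [op12, sub_whiskerRight']

lemma bisumBracket_inl_inl (Z : C) :
    A ◁ op11 biprod.inl Z ≫ op11 biprod.inl ((A ⊞ H) ⊗ Z) ≫ op21 (bisumBracket H A brH brA act) Z =
      op21 brA Z ≫ op11 biprod.inl Z := by
  rw [op21_tensorHom_comp, ← op21_comp]
  congr 1
  simp [bisumBracket]

lemma bisumBracket_inl_inl_assoc (Z : C) {K : C} (k : (A ⊞ H) ⊗ Z ⟶ K) :
    A ◁ op11 biprod.inl Z ≫ op11 biprod.inl ((A ⊞ H) ⊗ Z) ≫ op21 (bisumBracket H A brH brA act) Z ≫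
      k =
      op21 brA Z ≫ op11 biprod.inl Z ≫ k := by
  simpa only [Category.assoc] using eq_whisker (bisumBracket_inl_inl brH brA act Z) k

lemma bisumBracket_inr_inl (Z : C) :
    H ◁ op11 biprod.inl Z ≫ op11 biprod.inr ((A ⊞ H) ⊗ Z) ≫ op21 (bisumBracket H A brH brA act) Z =
      op21 act Z ≫ op11 biprod.inl Z := by
  rw [op21_tensorHom_comp, ← op21_comp]
  congr 1
  simp [bisumBracket]

lemma bisumBracket_inr_inl_assoc (Z : C) {K : C} (k : (A ⊞ H) ⊗ Z ⟶ K) :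
    H ◁ op11 biprod.inl Z ≫ op11 biprod.inr ((A ⊞ H) ⊗ Z) ≫ op21 (bisumBracket H A brH brA act) Z ≫
      k =
      op21 act Z ≫ op11 biprod.inl Z ≫ k := by
  simpa only [Category.assoc] using eq_whisker (bisumBracket_inr_inl brH brA act Z) k

lemma bisumBracket_inl_inr (Z : C) :
    A ◁ op11 biprod.inr Z ≫ op11 biprod.inl ((A ⊞ H) ⊗ Z) ≫ op21 (bisumBracket H A brH brA act) Z =
      -(swap A H Z ≫ op21 act Z ≫ op11 biprod.inl Z) := by
  rw [op21_tensorHom_comp, ← op21_comp, ← op21_braiding_comp, ← op21_neg]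
  congr 1
  simp [bisumBracket]

lemma bisumBracket_inl_inr_assoc (Z : C) {K : C} (k : (A ⊞ H) ⊗ Z ⟶ K) :
    A ◁ op11 biprod.inr Z ≫ op11 biprod.inl ((A ⊞ H) ⊗ Z) ≫ op21 (bisumBracket H A brH brA act) Z ≫
      k =
      (-(swap A H Z ≫ op21 act Z ≫ op11 biprod.inl Z)) ≫ k := by
  simpa only [Category.assoc] using eq_whisker (bisumBracket_inl_inr brH brA act Z) k

lemma bisumBracket_inr_inr (Z : C) :
    H ◁ op11 biprod.inr Z ≫ op11 biprod.inr ((A ⊞ H) ⊗ Z) ≫ op21 (bisumBracket H A brH brA act) Z =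
      op21 brH Z ≫ op11 biprod.inr Z := by
  rw [op21_tensorHom_comp, ← op21_comp]
  congr 1
  simp [bisumBracket]

lemma bisumBracket_inr_inr_assoc (Z : C) {K : C} (k : (A ⊞ H) ⊗ Z ⟶ K) :
    H ◁ op11 biprod.inr Z ≫ op11 biprod.inr ((A ⊞ H) ⊗ Z) ≫ op21 (bisumBracket H A brH brA act) Z ≫
      k =
      op21 brH Z ≫ op11 biprod.inr Z ≫ k := by
  simpa only [Category.assoc] using eq_whisker (bisumBracket_inr_inr brH brA act Z) k

lemma bisumCobracket_inl (Z : C) :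
    op11 biprod.inl Z ≫ op12 (bisumCobracket H A δH δA φ) Z =
      op12 δA Z ≫ A ◁ op11 biprod.inl Z ≫ op11 biprod.inl ((A ⊞ H) ⊗ Z) +
      op12 φ Z ≫ H ◁ op11 biprod.inl Z ≫ op11 biprod.inr ((A ⊞ H) ⊗ Z) -
      op12 φ Z ≫ swap H A Z ≫ A ◁ op11 biprod.inr Z ≫ op11 biprod.inl ((A ⊞ H) ⊗ Z) := by
  have e : biprod.inl ≫ bisumCobracket H A δH δA φ = δA ≫ (biprod.inl ⊗ₘ biprod.inl) +
      φ ≫ (biprod.inr ⊗ₘ biprod.inl) - (φ ≫ (β_ H A).hom) ≫ (biprod.inl ⊗ₘ biprod.inr) := by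
    simp [bisumCobracket]
  rw [op11_op12, e, op12_sub, op12_add, op12_comp_tensorHom, op12_comp_tensorHom,
    op12_comp_tensorHom,
    op12_comp_braiding, Category.assoc]

lemma bisumCobracket_inl_assoc (Z : C) {K : C} (k : (A ⊞ H) ⊗ (A ⊞ H) ⊗ Z ⟶ K) :
    op11 biprod.inl Z ≫ op12 (bisumCobracket H A δH δA φ) Z ≫ k =
      (op12 δA Z ≫ A ◁ op11 biprod.inl Z ≫ op11 biprod.inl ((A ⊞ H) ⊗ Z) +
      op12 φ Z ≫ H ◁ op11 biprod.inl Z ≫ op11 biprod.inr ((A ⊞ H) ⊗ Z) -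
      op12 φ Z ≫ swap H A Z ≫ A ◁ op11 biprod.inr Z ≫ op11 biprod.inl ((A ⊞ H) ⊗ Z)) ≫ k := by
  simpa only [Category.assoc] using eq_whisker (bisumCobracket_inl δH δA φ Z) k

lemma bisumCobracket_inr (Z : C) :
    op11 biprod.inr Z ≫ op12 (bisumCobracket H A δH δA φ) Z =
      op12 δH Z ≫ H ◁ op11 biprod.inr Z ≫ op11 biprod.inr ((A ⊞ H) ⊗ Z) := by
  rw [op11_op12, ← op12_comp_tensorHom]
  congr 1
  simp [bisumCobracket]

lemma bisumCobracket_inr_assoc (Z : C) {K : C} (k : (A ⊞ H) ⊗ (A ⊞ H) ⊗ Z ⟶ K) :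
    op11 biprod.inr Z ≫ op12 (bisumCobracket H A δH δA φ) Z ≫ k =
      op12 δH Z ≫ H ◁ op11 biprod.inr Z ≫ op11 biprod.inr ((A ⊞ H) ⊗ Z) ≫ k := by
  simpa only [Category.assoc] using eq_whisker (bisumCobracket_inr δH δA φ Z) k

end Bisum

section Whisker

variable {C : Type u} [Category.{v} C] [MonoidalCategory C]

lemma whiskerLeft_comp_eq_assoc {P Q R : C} {a : P ⟶ Q} {b : Q ⟶ R} {d : P ⟶ R}
    (h : a ≫ b = d) (X : C) {K : C} (k : X ⊗ R ⟶ K) :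
    X ◁ a ≫ X ◁ b ≫ k = X ◁ d ≫ k := by simp [← h]

lemma whiskerLeft_comp_comp_eq_assoc {P Q R S : C} {a : P ⟶ Q} {b : Q ⟶ R} {c : R ⟶ S} {d : P ⟶ S}
    (h : a ≫ b ≫ c = d) (X : C) {K : C} (k : X ⊗ S ⟶ K) :
    X ◁ a ≫ X ◁ b ≫ X ◁ c ≫ k = X ◁ d ≫ k := by simp [← h]

lemma whiskerRight_unit_injective {X Y : C} {f g : X ⟶ Y} (h : f ▷ 𝟙_ C = g ▷ 𝟙_ C) : f = g := by
  simpa using h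

end Whisker

/-! ### Jacobi, co-Jacobi and cocycle identities on words. -/

section Jacobi

variable {C : Type u} [Category.{v} C] [MonoidalCategory C] [BraidedCategory C] [Preadditive C]
  [MonoidalPreadditive C]

lemma op_jacobi {L : C} {br : L ⊗ L ⟶ L} (h : IsBraidedLieAlgebra L br) (Z : C) :
    op21 br (L ⊗ Z) ≫ op21 br Z +
      L ◁ swap L L Z ≫ swap L L (L ⊗ Z) ≫ op21 br (L ⊗ Z) ≫ op21 br Z +
      swap L L (L ⊗ Z) ≫ L ◁ swap L L Z ≫ op21 br (L ⊗ Z) ≫ op21 br Z = 0 := by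
  rw [← cancel_epi (α_ L L (L ⊗ Z)).hom, ← cancel_epi (α_ (L ⊗ L) L Z).hom,
    ← jacobi_whiskerRight, h.jacobi, MonoidalPreadditive.zero_whiskerRight, comp_zero, comp_zero]

lemma op_cojacobi {L : C} {δ : L ⟶ L ⊗ L} (h : IsBraidedLieCoalgebra L δ) (Z : C) :
    op12 δ Z ≫ op12 δ (L ⊗ Z) +
      op12 δ Z ≫ op12 δ (L ⊗ Z) ≫ L ◁ swap L L Z ≫ swap L L (L ⊗ Z) +
      op12 δ Z ≫ op12 δ (L ⊗ Z) ≫ swap L L (L ⊗ Z) ≫ L ◁ swap L L Z = 0 := by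
  rw [← cancel_mono (α_ L L (L ⊗ Z)).inv, ← cancel_mono (α_ (L ⊗ L) L Z).inv, Category.assoc,
    ← cojacobi_whiskerRight, h.jacobi, MonoidalPreadditive.zero_whiskerRight, zero_comp, zero_comp]

lemma op_cocycle {L : C} {br : L ⊗ L ⟶ L} {δ : L ⟶ L ⊗ L} (h : IsBraidedLieBialgebra L br δ)
    (Z : C) :
    op21 br Z ≫ op12 δ Z = (𝟙 _ - swap L L Z) ≫ (L ◁ op12 δ Z ≫ op21 br (L ⊗ Z) +
      L ◁ op12 δ Z ≫ swap L L (L ⊗ Z) ≫ L ◁ op21 br Z) :=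
  (op_cocycle_iff br δ Z).1 (congrArg (· ▷ Z) h.cocycle)

end Jacobi

/-! ### The axioms for the bisum, component by component. -/

section Bisum

variable {C : Type u} [Category.{v} C] [MonoidalCategory C] [BraidedCategory C] [Preadditive C]
  [MonoidalPreadditive C] [HasBinaryBiproducts C] {H A : C}
  {brH : H ⊗ H ⟶ H} {δH : H ⟶ H ⊗ H} {brA : A ⊗ A ⟶ A} {δA : A ⟶ A ⊗ A}
  {act : H ⊗ A ⟶ A} {φ : A ⟶ H ⊗ A}

lemma isSymmetricOn_singleton_of_swap {L : C}
    (h : swap L L (𝟙_ C) ≫ swap L L (𝟙_ C) = 𝟙 _) : IsSymmetricOn ({L} : Set C) := by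
  rintro U rfl V rfl
  rw [← Iso.comp_hom_eq_id]
  apply whiskerRight_unit_injective
  rw [comp_whiskerRight, braiding_whiskerRight_eq_swap]
  simp [reassoc_of% h]

lemma bisum_symm (h : IsSymmetricOn ({A, H} : Set C)) :
    IsSymmetricOn ({A ⊞ H} : Set C) := by
  have hAA := swap_swap_assoc (h A (by simp) A (by simp))
  have hAH := swap_swap_assoc (h A (by simp) H (by simp))
  have hHA := swap_swap_assoc (h H (by simp) A (by simp))
  have hHH := swap_swap_assoc (h H (by simp) H (by simp))
  apply isSymmetricOn_singleton_of_swap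
  apply op11_biprod_hom_ext <;> apply whiskerLeft_op11_biprod_hom_ext <;>
    simp [hAA, hAH, hHA, hHH]

lemma bisum_lie_antisymm (h : IsSymmetricOn ({A, H} : Set C)) (hA : IsBraidedLieAlgebra A brA)
    (hH : IsBraidedLieAlgebra H brH) :
    (𝟙 ((A ⊞ H) ⊗ (A ⊞ H)) + (β_ (A ⊞ H) (A ⊞ H)).hom) ≫ bisumBracket H A brH brA act = 0 := by
  have hAH := swap_swap_assoc (h A (by simp) H (by simp))
  have hHA := swap_swap_assoc (h H (by simp) A (by simp))
  have aA := fun Z => (op_antisymm hA Z)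
  have aH := fun Z => (op_antisymm hH Z)
  apply whiskerRight_unit_injective
  rw [antisymm_whiskerRight, MonoidalPreadditive.zero_whiskerRight]
  convert comp_zero
  apply op11_biprod_hom_ext <;> apply whiskerLeft_op11_biprod_hom_ext <;>
    simp [hHA, reassoc_of% aA, reassoc_of% aH, bisumBracket_inl_inl, bisumBracket_inl_inr,
      bisumBracket_inr_inl, bisumBracket_inr_inr]

lemma bisum_colie_antisymm (h : IsSymmetricOn ({A, H} : Set C)) (hA : IsBraidedLieCoalgebra A δA)
    (hH : IsBraidedLieCoalgebra H δH) :
    bisumCobracket H A δH δA φ ≫ (𝟙 ((A ⊞ H) ⊗ (A ⊞ H)) + (β_ (A ⊞ H) (A ⊞ H)).hom) = 0 := by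
  have hAH := swap_swap_assoc (h A (by simp) H (by simp))
  have hHA := swap_swap_assoc (h H (by simp) A (by simp))
  have aA := fun Z => (op_coantisymm hA Z)
  have aH := fun Z => (op_coantisymm hH Z)
  apply whiskerRight_unit_injective
  rw [coantisymm_whiskerRight, MonoidalPreadditive.zero_whiskerRight]
  convert zero_comp
  apply op11_biprod_hom_ext <;>
    simp [hHA, reassoc_of% aA, reassoc_of% aH, bisumCobracket_inl, bisumCobracket_inl_assoc,
      bisumCobracket_inr, bisumCobracket_inr_assoc]
  abel

/-- Among the eight components, AAA and HHH are the Jacobi identities of the summands, those with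
one `H` say that `H` acts by derivations, and those with two say that it acts. -/
lemma bisum_jacobi (h : IsSymmetricOn ({A, H} : Set C)) (hA : IsBraidedLieAlgebra A brA)
    (hH : IsBraidedLieAlgebra H brH)
    (hm : ∀ Z, op21 brH (A ⊗ Z) ≫ op21 act Z =
      H ◁ op21 act Z ≫ op21 act Z - swap H H (A ⊗ Z) ≫ H ◁ op21 act Z ≫ op21 act Z)
    (hd : ∀ Z, H ◁ op21 brA Z ≫ op21 act Z =
      op21 act (A ⊗ Z) ≫ op21 brA Z + swap H A (A ⊗ Z) ≫ A ◁ op21 act Z ≫ op21 brA Z) :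
    (𝟙 (((A ⊞ H) ⊗ (A ⊞ H)) ⊗ (A ⊞ H)) + braid23 (A ⊞ H) ≫ braid12 (A ⊞ H) +
      braid12 (A ⊞ H) ≫ braid23 (A ⊞ H)) ≫ bisumBracket H A brH brA act ▷ (A ⊞ H) ≫
        bisumBracket H A brH brA act = 0 := by
  have hAH := swap_swap_assoc (h A (by simp) H (by simp))
  have hHA := swap_swap_assoc (h H (by simp) A (by simp))
  have hAH₁ := whiskerLeft_swap_swap_assoc (h A (by simp) H (by simp))
  have hHA₁ := whiskerLeft_swap_swap_assoc (h H (by simp) A (by simp))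
  have hHH := swap_swap_assoc (h H (by simp) H (by simp))
  have hAA := swap_swap_assoc (h A (by simp) A (by simp))
  have hHH₁ := whiskerLeft_swap_swap_assoc (h H (by simp) H (by simp))
  have hAA₁ := whiskerLeft_swap_swap_assoc (h A (by simp) A (by simp))
  have aA := fun Z => (op_antisymm hA Z)
  have aH := fun Z => (op_antisymm hH Z)
  -- [a, h·b] = −[h·b, a], so that only one arrangement of these terms remains.
  have hn : ∀ Z, A ◁ op21 act Z ≫ op21 brA Z =
      -(swap A H (A ⊗ Z) ≫ H ◁ swap A A Z ≫ op21 act (A ⊗ Z) ≫ op21 brA Z) := by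
    intro Z
    rw [← neg_inj, ← Preadditive.comp_neg, ← aA]
    simp
  have jA := congrArg (· ≫ op11 (biprod.inl : A ⟶ A ⊞ H) _) (op_jacobi hA (𝟙_ C))
  have jH := congrArg (· ≫ op11 (biprod.inr : H ⟶ A ⊞ H) _) (op_jacobi hH (𝟙_ C))
  simp [reassoc_of% aA] at jA
  simp [reassoc_of% aH] at jH
  apply whiskerRight_unit_injective
  rw [jacobi_whiskerRight, MonoidalPreadditive.zero_whiskerRight]
  convert comp_zero
  convert comp_zero
  apply op11_biprod_hom_ext <;> apply whiskerLeft_op11_biprod_hom_ext <;>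
  apply whiskerLeft_whiskerLeft_op11_biprod_hom_ext <;>
    simp [hHA, hHA₁, hHH, hAA₁, hHH₁, reassoc_of% aA, reassoc_of% aH, bisumBracket_inl_inl,
      bisumBracket_inl_inr,
      bisumBracket_inr_inl, bisumBracket_inr_inr, bisumBracket_inl_inl_assoc,
        bisumBracket_inl_inr_assoc,
      bisumBracket_inr_inl_assoc, bisumBracket_inr_inr_assoc, reassoc_of% hm, reassoc_of% hd,
        reassoc_of% hn]
  all_goals first | exact jA | exact jH | abel_nf; trace_state

/-- Dual to `bisum_jacobi`: on `A` the terms sort by the number of `H` letters into co-Jacobi for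
`A`, colinearity of its cobracket and the comodule axiom; on `H` only co-Jacobi remains. -/
lemma bisum_cojacobi (h : IsSymmetricOn ({A, H} : Set C)) (hA : IsBraidedLieCoalgebra A δA)
    (hH : IsBraidedLieCoalgebra H δH)
    (hm : ∀ Z, op12 φ Z ≫ op12 δH (A ⊗ Z) =
      op12 φ Z ≫ H ◁ op12 φ Z - op12 φ Z ≫ H ◁ op12 φ Z ≫ swap H H (A ⊗ Z))
    (hd : ∀ Z, op12 φ Z ≫ H ◁ op12 δA Z = op12 δA Z ≫ op12 φ (A ⊗ Z) +
      op12 δA Z ≫ A ◁ op12 φ Z ≫ swap A H (A ⊗ Z)) :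
    bisumCobracket H A δH δA φ ≫ bisumCobracket H A δH δA φ ▷ (A ⊞ H) ≫
    (𝟙 (((A ⊞ H) ⊗ (A ⊞ H)) ⊗ (A ⊞ H)) + braid23 (A ⊞ H) ≫ braid12 (A ⊞ H) +
      braid12 (A ⊞ H) ≫ braid23 (A ⊞ H)) = 0 := by
  have hAH := swap_swap_assoc (h A (by simp) H (by simp))
  have hHA := swap_swap_assoc (h H (by simp) A (by simp))
  have hAH₁ := whiskerLeft_swap_swap_assoc (h A (by simp) H (by simp))
  have hHA₁ := whiskerLeft_swap_swap_assoc (h H (by simp) A (by simp))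
  have hHH := swap_swap_assoc (h H (by simp) H (by simp))
  have hAA := swap_swap_assoc (h A (by simp) A (by simp))
  have hHH₁ := whiskerLeft_swap_swap_assoc (h H (by simp) H (by simp))
  have hAA₁ := whiskerLeft_swap_swap_assoc (h A (by simp) A (by simp))
  have aA := fun Z => (op_coantisymm hA Z)
  have aH := fun Z => (op_coantisymm hH Z)
  have hn : ∀ Z, op12 δA Z ≫ A ◁ op12 φ Z =
      -(op12 δA Z ≫ op12 φ (A ⊗ Z) ≫ H ◁ swap A A Z ≫ swap H A (A ⊗ Z)) := by
    intro Z
    rw [← neg_inj, ← Preadditive.neg_comp, ← aA]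
    simp
  have jA := congrArg (· ≫ A ◁ A ◁ op11 (biprod.inl : A ⟶ A ⊞ H) _ ≫
    A ◁ op11 (biprod.inl : A ⟶ A ⊞ H) _ ≫ op11 (biprod.inl : A ⟶ A ⊞ H) _) (op_cojacobi hA (𝟙_ C))
  have jH := congrArg (· ≫ H ◁ H ◁ op11 (biprod.inr : H ⟶ A ⊞ H) _ ≫
    H ◁ op11 (biprod.inr : H ⟶ A ⊞ H) _ ≫ op11 (biprod.inr : H ⟶ A ⊞ H) _) (op_cojacobi hH (𝟙_ C))
  simp [reassoc_of% aA] at jA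
  simp [reassoc_of% aH] at jH
  apply whiskerRight_unit_injective
  rw [cojacobi_whiskerRight, MonoidalPreadditive.zero_whiskerRight]
  convert zero_comp
  apply op11_biprod_hom_ext <;>
    simp [hAH, hHA, hHA₁, hHH, hHH₁, reassoc_of% aA, reassoc_of% aH,
     bisumCobracket_inl, bisumCobracket_inl_assoc, bisumCobracket_inr, bisumCobracket_inr_assoc,
       reassoc_of% hm, reassoc_of% hd, reassoc_of% hn]
  · refine Eq.trans ?_ jA
    abel
  · exact jH

/-- From A ⊗ A, the part in A ⊗ A is (SLB) and the mixed parts are colinearity of the bracket. From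
H ⊗ A, they are the coderivation property and the crossed-module identity; A ⊗ H is similar up to
braiding and sign. On H ⊗ H it is the cocycle condition of `H`. -/
lemma bisum_cocycle (h : IsSymmetricOn ({A, H} : Set C)) (hA : IsBraidedLieAlgebra A brA)
    (hA' : IsBraidedLieCoalgebra A δA)
    (hH : IsBraidedLieBialgebra H brH δH)
    (hc : ∀ Z, op21 brA Z ≫ op12 φ Z = op12 φ (A ⊗ Z) ≫ H ◁ op21 brA Z +
      A ◁ op12 φ Z ≫ swap A H (A ⊗ Z) ≫ H ◁ op21 brA Z)
    (hd : ∀ Z, op21 act Z ≫ op12 δA Z =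
      H ◁ op12 δA Z ≫ op21 act (A ⊗ Z) +
      H ◁ op12 δA Z ≫ swap H A (A ⊗ Z) ≫ A ◁ op21 act Z)
    (hyd : ∀ Z, op21 act Z ≫ op12 φ Z =
      H ◁ op12 φ Z ≫ op21 brH (A ⊗ Z) +
      H ◁ op12 φ Z ≫ swap H H (A ⊗ Z) ≫ H ◁ op21 act Z +
      op12 δH (A ⊗ Z) ≫ H ◁ op21 act Z)
    (hSLB : SLB H A brA δA act φ) :
    bisumBracket H A brH brA act ≫ bisumCobracket H A δH δA φ =
      (𝟙 ((A ⊞ H) ⊗ (A ⊞ H)) - (β_ (A ⊞ H) (A ⊞ H)).hom) ≫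
        adCobracket (A ⊞ H) (bisumBracket H A brH brA act) (bisumCobracket H A δH δA φ) := by
  have hAH := swap_swap_assoc (h A (by simp) H (by simp))
  have hHA := swap_swap_assoc (h H (by simp) A (by simp))
  have hAH₁ := whiskerLeft_swap_swap_assoc (h A (by simp) H (by simp))
  have hHA₁ := whiskerLeft_swap_swap_assoc (h H (by simp) A (by simp))
  have hHH := swap_swap_assoc (h H (by simp) H (by simp))
  have hAA := swap_swap_assoc (h A (by simp) A (by simp))
  have hHH₁ := whiskerLeft_swap_swap_assoc (h H (by simp) H (by simp))
  have hAA₁ := whiskerLeft_swap_swap_assoc (h A (by simp) A (by simp))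
  have aA := fun Z => (op_antisymm hA Z)
  have aH := fun Z => (op_antisymm hH.lieAlgebra Z)
  have cA := fun Z => (op_coantisymm hA' Z)
  have cH := fun Z => (op_coantisymm hH.lieCoalgebra Z)
  -- Exchanging two `A` letters commutes with carrying `H` past both, by Yang–Baxter; antisymmetry
  -- then gives the sign.
  have hy : ∀ Z, H ◁ swap A A Z ≫ swap H A (A ⊗ Z) ≫ A ◁ swap H A Z ≫ op21 brA (H ⊗ Z) =
      -(swap H A (A ⊗ Z) ≫ A ◁ swap H A Z ≫ op21 brA (H ⊗ Z)) := by
    intro Z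
    rw [← swap_yang_baxter_assoc, aA]
    simp only [Preadditive.comp_neg]
  have hS := op_SLB hSLB
  have hC := op_cocycle hH
  apply whiskerRight_unit_injective
  rw [op_cocycle_iff]
  apply op11_biprod_hom_ext <;> apply whiskerLeft_op11_biprod_hom_ext <;>
    simp [hAH, hHA, hAH₁, hHA₁, hAA, hHH, hAA₁, reassoc_of% aA, reassoc_of% aH, reassoc_of% cH,
      bisumBracket_inl_inl, bisumBracket_inl_inr,
      bisumBracket_inr_inl, bisumBracket_inr_inr, bisumBracket_inl_inl_assoc,
        bisumBracket_inl_inr_assoc,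
      bisumBracket_inr_inl_assoc, bisumBracket_inr_inr_assoc,
     bisumCobracket_inl, bisumCobracket_inl_assoc, bisumCobracket_inr, bisumCobracket_inr_assoc,
       reassoc_of% hS, reassoc_of% hC,
     reassoc_of% hc, reassoc_of% hd, reassoc_of% hyd,
     fun Z => whiskerLeft_comp_eq_assoc (aA Z), fun Z => whiskerLeft_comp_eq_assoc (aH Z),
     fun Z => whiskerLeft_comp_eq_assoc (bisumCobracket_inl δH δA φ Z),
       fun Z => whiskerLeft_comp_eq_assoc (bisumCobracket_inr δH δA φ Z),
     fun Z => whiskerLeft_comp_comp_eq_assoc (bisumBracket_inl_inl brH brA act Z),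
       fun Z => whiskerLeft_comp_comp_eq_assoc (bisumBracket_inl_inr brH brA act Z),
     fun Z => whiskerLeft_comp_comp_eq_assoc (bisumBracket_inr_inl brH brA act Z),
       fun Z => whiskerLeft_comp_comp_eq_assoc (bisumBracket_inr_inr brH brA act Z),
     whiskerLeft_neg', whiskerLeft_sub', reassoc_of% hy]
  all_goals abel

/-- The bisum of a Lie algebra and coalgebra `A` in the category of crossed modules over a
braided Lie bialgebra `H` is a braided Lie bialgebra. -/
theorem bisum_isBraidedLieBialgebra (h : IsSymmetricOn ({A, H} : Set C))
    (hA : IsBraidedLieAlgebra A brA) (hA' : IsBraidedLieCoalgebra A δA)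
    (hH : IsBraidedLieBialgebra H brH δH)
    (hmod : ∀ Z, op21 brH (A ⊗ Z) ≫ op21 act Z =
      H ◁ op21 act Z ≫ op21 act Z - swap H H (A ⊗ Z) ≫ H ◁ op21 act Z ≫ op21 act Z)
    (hcomod : IsLeftComodule H A δH φ)
    (hder : ∀ Z, H ◁ op21 brA Z ≫ op21 act Z =
      op21 act (A ⊗ Z) ≫ op21 brA Z + swap H A (A ⊗ Z) ≫ A ◁ op21 act Z ≫ op21 brA Z)
    (hcoder : ∀ Z, op21 act Z ≫ op12 δA Z =
      H ◁ op12 δA Z ≫ op21 act (A ⊗ Z) +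
      H ◁ op12 δA Z ≫ swap H A (A ⊗ Z) ≫ A ◁ op21 act Z)
    (hcol : ∀ Z, op21 brA Z ≫ op12 φ Z = op12 φ (A ⊗ Z) ≫ H ◁ op21 brA Z +
      A ◁ op12 φ Z ≫ swap A H (A ⊗ Z) ≫ H ◁ op21 brA Z)
    (hcocol : ∀ Z, op12 φ Z ≫ H ◁ op12 δA Z = op12 δA Z ≫ op12 φ (A ⊗ Z) +
      op12 δA Z ≫ A ◁ op12 φ Z ≫ swap A H (A ⊗ Z))
    (hcross : ∀ Z, op21 act Z ≫ op12 φ Z =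
      H ◁ op12 φ Z ≫ op21 brH (A ⊗ Z) +
      H ◁ op12 φ Z ≫ swap H H (A ⊗ Z) ≫ H ◁ op21 act Z +
      op12 δH (A ⊗ Z) ≫ H ◁ op21 act Z)
    (hSLB : SLB H A brA δA act φ) :
    IsBraidedLieBialgebra (A ⊞ H) (bisumBracket H A brH brA act)
      (bisumCobracket H A δH δA φ) where
  lieAlgebra :=
    { symm := bisum_symm h
      antisymm := bisum_lie_antisymm h hA hH.lieAlgebra
      jacobi := bisum_jacobi h hA hH.lieAlgebra hmod hder }
  lieCoalgebra :=
    { symm := bisum_symm h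
      antisymm := bisum_colie_antisymm h hA' hH.lieCoalgebra
      jacobi := bisum_cojacobi h hA' hH.lieCoalgebra (op_comodule hcomod) hcocol }
  cocycle := bisum_cocycle h hA hA' hH hcol hcoder hcross hSLB

end Bisum

end BraidedLie

theorem corollary2p3 {C : Type u} [Category.{v} C] [Preadditive C] [HasZeroObject C]
    [HasBinaryBiproducts C]
    [MonoidalCategory C] [MonoidalPreadditive C] [BraidedCategory C]
    (H A : C) (hsymm : BraidedLie.IsSymmetricOn ({A, H} : Set C))
    (brH : H ⊗ H ⟶ H) (δH : H ⟶ H ⊗ H) (r : H ⊗ H ⟶ 𝟙_ C)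
    (hH : BraidedLie.IsCoquasitriangular H brH δH r)
    (brA : A ⊗ A ⟶ A) (δA : A ⟶ A ⊗ A) (φ : A ⟶ H ⊗ A)
    (hA : BraidedLie.IsComoduleLieAlgebra H A δH brA φ)
    (hA' : BraidedLie.IsComoduleLieCoalgebra H A δH δA φ)
    (hSLB : BraidedLie.SLB H A brA δA (BraidedLie.inducedAction H A r φ) φ) :
    BraidedLie.IsBraidedLieBialgebra (A ⊞ H)
      (BraidedLie.bisumBracket H A brH brA (BraidedLie.inducedAction H A r φ))
      (BraidedLie.bisumCobracket H A δH δA φ) := by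
  have hHH : (β_ H H).hom = (β_ H H).inv := hsymm H (by simp) H (by simp)
  have hAH : (β_ A H).hom = (β_ H A).inv := hsymm A (by simp) H (by simp)
  exact BraidedLie.bisum_isBraidedLieBialgebra hsymm hA.lieAlgebra hA'.lieCoalgebra hH.bialgebra
    (BraidedLie.op_action_bracket hHH hH hA.comodule) hA.comodule
    (BraidedLie.op_action_derivation hAH hA) (BraidedLie.op_action_coderivation hAH hA')
    (BraidedLie.op_bracket_colinear hA) (BraidedLie.op_cobracket_colinear hA')
    (BraidedLie.op_action_coaction hHH hH hA.comodule) hSLB
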